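/- Let $G$ be a second-countable locally compact Hausdorff étale groupoid, with space of objects $G_0$, space of arrows $G_1$, domain and range maps $d,r:G_1\to G_0$ and unit map $u:G_0\to G_1$ (étale means that $d$ is a local homeomorphism). Let $A=C_r^*(G)$ be its reduced C*-algebra, i.e. the completion of the convolution algebra $C_c(G)$ in the norm of the left regular representation on $\ell^2(G_1)=\bigoplus_{x\in G_0}\ell^2(d^{-1}(x))$; its elements are regarded as continuous functions on $G_1$. Let $\operatorname{Max}A$ be the set of closed linear subspaces of $A$, with the lower Vietoris topology, the product $PQ=\overline{\operatorname{span}}\{ab: a\in P,\ b\in Q\}$ and the pointwise involution. Let $\mathrm{ms}(G)$ be the lattice of open subsets of $G_1$, with the Scott topology, the pointwise product, the pointwise involution, and the unit $e=u(G_0)$. Put $$\iota(U)=\overline{C_c(U)}\subset A,\qquad \rho(V)=\bigcup_{f\in V}\{g\in G_1: f(g)\neq 0\}\qquad (U\in \mathrm{ms}(G),\ V\in\operatorname{Max}A),$$ where $C_c(U)$ is the set of $f\in C_c(G)$ with support contained in $U$. A sober lattice is a sober space whose specialization order has a least element $0$ and binary joins, the join being continuous; its homomorphisms are the continuous maps that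 preserve $0$ and $\vee$. A measurement space is a sober lattice with a continuous associative product and a continuous involution such that $m0=0$, $m(n\vee n')=mn\vee mn'$, $m^{**}=m$, $(mn)^*=n^*m^*$, and $mm^*m\le m\Rightarrow m\le mm^*m$; its homomorphisms also preserve product and involution. An observer of a measurement space $M$ consists of a measurement space $\mathcal O$, a homomorphism of measurement spaces $\iota:\mathcal O\to M$ and a homomorphism of sober lattices $\rho:M\to\mathcal O$ with $\rho\circ\iota=\mathrm{id}$, $\rho(m^*)=\rho(m)^*$ and $\rho(m\,\iota(\omega))=\rho(m)\omega$ for all $m\in M$, $\omega\in\mathcal O$. It is persistent if $\rho(m\,\iota(\omega)\,n)=\rho(m)\,\omega\,\rho(n)$ for all $m,n\in M$, $\omega\in\mathcal O$. For a unital $\mathcal O$ with unit $e$ let $\mathcal I(\mathcal O)=\{s: ss^*\le e,\ s^*s\le e\}$. An inverse quantal frame is a unital involutive quantale which is a locale, satisfies $a a^*a\le a\Rightarrow a\le aa^*a$, and whose top element is $\bigvee\mathcal I(\mathcal O)$. A measurement space is classical if it is a countably-based locally compact locale with the Scott topology and satisfies $m\le mm^*m$ for all $m$. An observer is étale if $\mathcal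 O$ is a classical measurement space and an inverse quantal frame, and $\rho(m)\,\omega\,\rho(n)\le\rho(m\,\iota(\omega)\,n)$ for all $\omega\in\mathcal O$ and all $m,n\in M$ with $\rho(m),\rho(n)\in\mathcal I(\mathcal O)$. It is $\mathcal I$-stable if it is étale and, with $b=\iota(e)$, $\rho(s)\in\mathcal I(\mathcal O)$ for every $s\in M$ with $ss^*\le b$, $s^*s\le b$, $sb\le s$ and $bs\le s$. Then $(\mathrm{ms}(G),(\iota,\rho))$ is an observer of $\operatorname{Max}A$ (the associated observer of $G$), and: 1. If $G$ is principal (every isotropy group is trivial) and every orbit of $G$ is a discrete subspace of $G_0$, then the associated observer is persistent. 2. If the associated observer is persistent, then $G$ is principal. 3. If $G$ is topologically principal (the set of $x\in G_0$ with trivial isotropy group is dense in $G_0$), then the associated observer is $\mathcal I$-stable. -/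

import Mathlib

open Topology
open scoped CompactlySupported ENNReal

/-- A topological groupoid with space of objects `X` and space of arrows `G`.  An arrow `g` goes
from its domain `d g` to its range `r g`.  The product `mul g h` is meaningful only for composable
pairs, `d g = r h`, and every axiom about `mul` is restricted to such pairs. -/
structure TopGroupoid (X G : Type*) [TopologicalSpace X] [TopologicalSpace G] where
  d : G → X
  r : G → X
  u : X → G
  inv : G → G
  mul : G → G → G
  continuous_d : Continuous d
  continuous_r : Continuous r
  continuous_u : Continuous u
  continuous_inv : Continuous inv
  continuousOn_mul : ContinuousOn (fun p : G × G => mul p.1 p.2) {p | d p.1 = r p.2}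
  d_u : ∀ x, d (u x) = x
  r_u : ∀ x, r (u x) = x
  d_mul : ∀ g h, d g = r h → d (mul g h) = d h
  r_mul : ∀ g h, d g = r h → r (mul g h) = r g
  d_inv : ∀ g, d (inv g) = r g
  r_inv : ∀ g, r (inv g) = d g
  mul_assoc : ∀ g h k, d g = r h → d h = r k → mul (mul g h) k = mul g (mul h k)
  mul_u : ∀ g, mul g (u (d g)) = g
  u_mul : ∀ g, mul (u (r g)) g = g
  inv_mul : ∀ g, mul (inv g) g = u (d g)
  mul_inv : ∀ g, mul g (inv g) = u (r g)

/-- An étale groupoid: the domain map is a local homeomorphism. -/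
structure EtaleGroupoid (X G : Type*) [TopologicalSpace X] [TopologicalSpace G] extends
    TopGroupoid X G where
  isLocalHomeomorph_d : IsLocalHomeomorph d

namespace TopGroupoid

variable {X G : Type*} [TopologicalSpace X] [TopologicalSpace G] (𝒢 : TopGroupoid X G)

/-- `x` has trivial isotropy group. -/
def TrivialIsotropyAt (x : X) : Prop := ∀ g, 𝒢.d g = x → 𝒢.r g = x → g = 𝒢.u x

/-- Every isotropy group is trivial. -/
def IsPrincipal : Prop := ∀ x, 𝒢.TrivialIsotropyAt x

/-- The objects with trivial isotropy group are dense. -/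
def IsTopologicallyPrincipal : Prop := Dense {x | 𝒢.TrivialIsotropyAt x}

/-- The orbit of the object `x`. -/
def orbit (x : X) : Set X := {y | ∃ g, 𝒢.d g = x ∧ 𝒢.r g = y}

/-- Every orbit is a discrete subspace of the space of objects. -/
def HasDiscreteOrbits : Prop := ∀ x, DiscreteTopology (𝒢.orbit x)

theorem inv_u (x : X) : 𝒢.inv (𝒢.u x) = 𝒢.u x := by
  have h := 𝒢.mul_u (𝒢.inv (𝒢.u x))
  rw [𝒢.d_inv, 𝒢.r_u] at h
  have h2 := 𝒢.inv_mul (𝒢.u x)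
  rw [𝒢.d_u] at h2
  exact h.symm.trans h2

theorem mul_mul_inv_cancel {g h : G} (hgh : 𝒢.d g = 𝒢.r h) :
    𝒢.mul (𝒢.mul g h) (𝒢.inv h) = g := by
  rw [𝒢.mul_assoc g h _ hgh (𝒢.r_inv h).symm, 𝒢.mul_inv, ← hgh, 𝒢.mul_u]

theorem mul_inv_mul_cancel {g h : G} (hgh : 𝒢.d g = 𝒢.d h) :
    𝒢.mul (𝒢.mul g (𝒢.inv h)) h = g := by
  rw [𝒢.mul_assoc _ _ _ (by rw [𝒢.r_inv, hgh]) (𝒢.d_inv h), 𝒢.inv_mul, ← hgh, 𝒢.mul_u]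

theorem inv_inv (g : G) : 𝒢.inv (𝒢.inv g) = g := by
  have h := 𝒢.mul_mul_inv_cancel (g := g) (h := 𝒢.inv g) (𝒢.r_inv g).symm
  rw [𝒢.mul_inv, ← 𝒢.d_inv g, ← 𝒢.r_inv (𝒢.inv g), 𝒢.u_mul] at h
  exact h

/-- `(g k⁻¹)⁻¹ = k g⁻¹`. -/
theorem inv_mul_inv {g k : G} (h : 𝒢.d g = 𝒢.d k) :
    𝒢.inv (𝒢.mul g (𝒢.inv k)) = 𝒢.mul k (𝒢.inv g) := by
  have hc : 𝒢.d g = 𝒢.r (𝒢.inv k) := by rw [𝒢.r_inv, h]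
  have hc' : 𝒢.d k = 𝒢.r (𝒢.inv g) := by rw [𝒢.r_inv, h]
  set a := 𝒢.mul g (𝒢.inv k)
  set b := 𝒢.mul k (𝒢.inv g)
  have da : 𝒢.d a = 𝒢.r k := by rw [𝒢.d_mul _ _ hc, 𝒢.d_inv]
  have rb : 𝒢.r b = 𝒢.r k := 𝒢.r_mul _ _ hc'
  have hab : 𝒢.mul a b = 𝒢.u (𝒢.r g) := by
    rw [← 𝒢.mul_assoc a k _ da hc', 𝒢.mul_inv_mul_cancel h, 𝒢.mul_inv]
  have h1 : 𝒢.mul (𝒢.inv a) (𝒢.mul a b) = b := by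
    rw [← 𝒢.mul_assoc _ _ _ (𝒢.d_inv a) (da.trans rb.symm), 𝒢.inv_mul, da, ← rb, 𝒢.u_mul]
  rw [← h1, hab, ← 𝒢.r_mul g _ hc, ← 𝒢.d_inv, 𝒢.mul_u]

/-- `(g l⁻¹) (k l⁻¹)⁻¹ = g k⁻¹`. -/
theorem mul_inv_mul_inv {g k l : G} (h : 𝒢.d g = 𝒢.d k) (hkl : 𝒢.d k = 𝒢.d l) :
    𝒢.mul (𝒢.mul g (𝒢.inv l)) (𝒢.inv (𝒢.mul k (𝒢.inv l))) = 𝒢.mul g (𝒢.inv k) := by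
  have hc : 𝒢.d g = 𝒢.r (𝒢.inv l) := by rw [𝒢.r_inv, h, hkl]
  rw [𝒢.inv_mul_inv hkl, ← 𝒢.mul_assoc _ _ _ (by rw [𝒢.d_mul _ _ hc, 𝒢.d_inv])
    (by rw [𝒢.r_inv, hkl]), 𝒢.mul_inv_mul_cancel (h.trans hkl)]

open Classical in
/-- The kernel of left convolution by `f`: `kernel f g k = f (g k⁻¹)` if `d g = d k`, and `0`
otherwise. -/
noncomputable def kernel (f : G → ℂ) (g k : G) : ℂ :=
  if 𝒢.d g = 𝒢.d k then f (𝒢.mul g (𝒢.inv k)) else 0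

theorem kernel_pos (f : G → ℂ) {g k : G} (h : 𝒢.d g = 𝒢.d k) :
    𝒢.kernel f g k = f (𝒢.mul g (𝒢.inv k)) := if_pos h

theorem kernel_neg (f : G → ℂ) {g k : G} (h : ¬ 𝒢.d g = 𝒢.d k) :
    𝒢.kernel f g k = 0 := if_neg h

theorem kernel_u (f : G → ℂ) (g : G) : 𝒢.kernel f g (𝒢.u (𝒢.d g)) = f g := by
  rw [𝒢.kernel_pos f (𝒢.d_u _).symm, 𝒢.inv_u, 𝒢.mul_u]

theorem continuousOn_kernel {f : G → ℂ} (hf : Continuous f) :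
    ContinuousOn (fun p : G × G => 𝒢.kernel f p.1 p.2) {p | 𝒢.d p.1 = 𝒢.d p.2} := by
  have h1 : ContinuousOn (fun p : G × G => 𝒢.mul p.1 (𝒢.inv p.2)) {p | 𝒢.d p.1 = 𝒢.d p.2} := by
    refine 𝒢.continuousOn_mul.comp (f := fun p : G × G => (p.1, 𝒢.inv p.2))
      (continuous_fst.prodMk (𝒢.continuous_inv.comp continuous_snd)).continuousOn ?_
    intro p hp
    simpa [𝒢.r_inv] using hp
  exact (hf.comp_continuousOn h1).congr fun p hp => 𝒢.kernel_pos f hp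

/-- The space of objects is Hausdorff if the space of arrows is. -/
theorem t2Space {X G : Type*} [TopologicalSpace X] [TopologicalSpace G] (𝒢 : TopGroupoid X G)
    [T2Space G] : T2Space X :=
  T2Space.of_injective_continuous (f := 𝒢.u)
    (fun x y h => by rw [← 𝒢.d_u x, h, 𝒢.d_u]) 𝒢.continuous_u

/-- The convolution product: the sum over all decompositions `x = y z`, which are parametrized by
the `z` with `d z = d x` through `y = x z⁻¹`. -/
noncomputable def convFun (f g : G → ℂ) (x : G) : ℂ := ∑' z, 𝒢.kernel f x z * g z

theorem kernel_convFun (f g : G → ℂ) (x l : G) :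
    𝒢.kernel (𝒢.convFun f g) x l = ∑' k, 𝒢.kernel f x k * 𝒢.kernel g k l := by
  by_cases h : 𝒢.d x = 𝒢.d l
  · rw [𝒢.kernel_pos _ h, convFun]
    refine tsum_eq_tsum_of_ne_zero_bij (fun k => 𝒢.mul k.1 (𝒢.inv l)) ?_ ?_ ?_
    · rintro ⟨k, hk⟩ ⟨k', hk'⟩ e
      have hd : ∀ k, 𝒢.kernel f x k * 𝒢.kernel g k l ≠ 0 → 𝒢.d k = 𝒢.d l := by
        intro k hk
        by_contra hc
        exact hk (by rw [𝒢.kernel_neg g hc, mul_zero])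
      simp only at e
      have := congrArg (fun t => 𝒢.mul t l) e
      simp only [𝒢.mul_inv_mul_cancel (hd k hk), 𝒢.mul_inv_mul_cancel (hd k' hk')] at this
      exact Subtype.ext this
    · intro z hz
      have hz1 : 𝒢.d (𝒢.mul x (𝒢.inv l)) = 𝒢.d z := by
        by_contra hc
        exact hz (by simp only [𝒢.kernel_neg f hc, zero_mul])
      rw [𝒢.d_mul _ _ (by rw [𝒢.r_inv, h]), 𝒢.d_inv] at hz1
      have hk : 𝒢.mul (𝒢.mul z l) (𝒢.inv l) = z := 𝒢.mul_mul_inv_cancel hz1.symm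
      have hd : 𝒢.d (𝒢.mul z l) = 𝒢.d l := 𝒢.d_mul _ _ hz1.symm
      refine ⟨⟨𝒢.mul z l, ?_⟩, hk⟩
      rw [Function.mem_support] at hz ⊢
      rw [𝒢.kernel_pos g hd, hk, 𝒢.kernel_pos f (h.trans hd.symm)]
      rwa [𝒢.kernel_pos f, ← hk, 𝒢.mul_inv_mul_inv (h.trans hd.symm) hd, hk] at hz
      rw [𝒢.d_mul _ _ (by rw [𝒢.r_inv, h]), 𝒢.d_inv, hz1]
    · rintro ⟨k, hk⟩
      have hkl : 𝒢.d k = 𝒢.d l := by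
        by_contra hc
        exact hk (by simp only [𝒢.kernel_neg g hc, mul_zero])
      have hxk : 𝒢.d x = 𝒢.d k := h.trans hkl.symm
      simp only
      rw [𝒢.kernel_pos g hkl, 𝒢.kernel_pos f hxk, 𝒢.kernel_pos f,
        𝒢.mul_inv_mul_inv hxk hkl]
      rw [𝒢.d_mul _ _ (by rw [𝒢.r_inv, h]), 𝒢.d_mul _ _ (by rw [𝒢.r_inv, hkl])]
  · rw [𝒢.kernel_neg _ h]
    have hz : ∀ k, 𝒢.kernel f x k * 𝒢.kernel g k l = 0 := by
      intro k
      by_cases hk : 𝒢.d x = 𝒢.d k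
      · rw [𝒢.kernel_neg g fun hc => h (hk.trans hc), mul_zero]
      · rw [𝒢.kernel_neg f hk, zero_mul]
    simp only [hz, tsum_zero]

/-- The involution of the convolution algebra. -/
noncomputable def starFun (f : G → ℂ) (x : G) : ℂ := star (f (𝒢.inv x))

theorem kernel_starFun (f : G → ℂ) (g k : G) :
    𝒢.kernel (𝒢.starFun f) g k = star (𝒢.kernel f k g) := by
  by_cases h : 𝒢.d g = 𝒢.d k
  · rw [𝒢.kernel_pos _ h, 𝒢.kernel_pos _ h.symm, starFun, 𝒢.inv_mul_inv h]
  · rw [𝒢.kernel_neg _ h, 𝒢.kernel_neg _ (Ne.symm h), star_zero]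

end TopGroupoid

namespace EtaleGroupoid

variable {X G : Type*} [TopologicalSpace X] [TopologicalSpace G] (𝒢 : EtaleGroupoid X G)

theorem exists_injOn_d (g : G) : ∃ U : Set G, IsOpen U ∧ g ∈ U ∧ Set.InjOn 𝒢.d U := by
  obtain ⟨e, he, hd⟩ := 𝒢.isLocalHomeomorph_d g
  exact ⟨e.source, e.open_source, he, hd ▸ e.injOn⟩

theorem exists_card_fiber_d_le {K : Set G} (hK : IsCompact K) :
    ∃ N : ℕ, ∀ x, ∀ F : Finset G, (∀ h ∈ F, h ∈ K ∧ 𝒢.d h = x) → F.card ≤ N := by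
  choose U hU hgU hinj using 𝒢.exists_injOn_d
  obtain ⟨t, ht⟩ := hK.elim_finite_subcover U hU (fun g _ => Set.mem_iUnion.2 ⟨g, hgU g⟩)
  refine ⟨t.card, fun x F hF => ?_⟩
  have hex : ∀ h ∈ F, ∃ i ∈ t, h ∈ U i := fun h hh => by
    simpa using ht (hF h hh).1
  choose! φ hφ1 hφ2 using hex
  refine Finset.card_le_card_of_injOn φ hφ1 ?_
  intro a ha b hb hab
  exact hinj (φ a) (hφ2 a ha) (hab ▸ hφ2 b hb) ((hF a ha).2.trans (hF b hb).2.symm)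

theorem exists_card_fiber_r_le {K : Set G} (hK : IsCompact K) :
    ∃ N : ℕ, ∀ x, ∀ F : Finset G, (∀ h ∈ F, h ∈ K ∧ 𝒢.r h = x) → F.card ≤ N := by
  classical
  obtain ⟨N, hN⟩ := 𝒢.exists_card_fiber_d_le (hK.image 𝒢.continuous_inv)
  refine ⟨N, fun x F hF => ?_⟩
  have hinj : Function.Injective 𝒢.inv := Function.LeftInverse.injective 𝒢.inv_inv
  rw [← Finset.card_image_of_injective F hinj]
  refine hN x _ fun h hh => ?_
  obtain ⟨k, hk, rfl⟩ := Finset.mem_image.1 hh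
  exact ⟨⟨k, (hF k hk).1, rfl⟩, by rw [𝒢.d_inv, (hF k hk).2]⟩

theorem finite_fiber_d {K : Set G} (hK : IsCompact K) (x : X) :
    {h | h ∈ K ∧ 𝒢.d h = x}.Finite := by
  obtain ⟨N, hN⟩ := 𝒢.exists_card_fiber_d_le hK
  by_contra hinf
  obtain ⟨F, hF, hc⟩ := (show Set.Infinite _ from hinf).exists_subset_card_eq (N + 1)
  have := hN x F (fun h hh => hF hh)
  omega

theorem continuous_convFun [T2Space G] {f g : G → ℂ} (hf : Continuous f) (hg : Continuous g)
    (hgc : HasCompactSupport g) : Continuous (𝒢.convFun f g) := by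
  classical
  have : T2Space X := 𝒢.t2Space
  rw [continuous_iff_continuousAt]
  intro x₀
  set F := {h | h ∈ tsupport g ∧ 𝒢.d h = 𝒢.d x₀} with hFdef
  have hF : F.Finite := 𝒢.finite_fiber_d hgc _
  obtain ⟨U, hU, hdisj⟩ := hF.t2_separation
  choose e he hed using 𝒢.isLocalHomeomorph_d
  have hed' : ∀ z y, e z y = 𝒢.d y := fun z y => (congrFun (hed z) y).symm
  set V : G → Set G := fun z => U z ∩ (e z).source
  have hV : ∀ z, IsOpen (V z) := fun z => (hU z).2.inter (e z).open_source
  have hzV : ∀ z, z ∈ V z := fun z => ⟨(hU z).1, he z⟩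
  set σ : G → X → G := fun z => (e z).symm
  have hσ : ∀ z, ∀ y ∈ V z, σ z (𝒢.d y) = y := fun z y hy => by
    rw [← hed' z y]; exact (e z).left_inv hy.2
  have hK : IsClosed (𝒢.d '' (tsupport g \ ⋃ z ∈ F, V z)) :=
    ((hgc.isCompact.diff (isOpen_biUnion fun z _ => hV z)).image 𝒢.continuous_d).isClosed
  have hx₀K : 𝒢.d x₀ ∈ (𝒢.d '' (tsupport g \ ⋃ z ∈ F, V z))ᶜ := by
    rintro ⟨z, ⟨hz1, hz2⟩, hz3⟩
    exact hz2 (Set.mem_biUnion (show z ∈ F from ⟨hz1, hz3⟩) (hzV z))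
  have hW : ∀ᶠ x in 𝓝 x₀, 𝒢.d x ∈ (𝒢.d '' (tsupport g \ ⋃ z ∈ F, V z))ᶜ ∧
      ∀ z ∈ F, 𝒢.d x ∈ 𝒢.d '' V z := by
    refine (𝒢.continuous_d.continuousAt.eventually (hK.isOpen_compl.mem_nhds hx₀K)).and ?_
    rw [Filter.eventually_all_finite hF]
    intro z hz
    refine 𝒢.continuous_d.continuousAt.eventually
      ((𝒢.isLocalHomeomorph_d.isOpenMap _ (hV z)).mem_nhds ⟨z, hzV z, hz.2⟩)
  have hσV : ∀ x, ∀ z, 𝒢.d x ∈ 𝒢.d '' V z → σ z (𝒢.d x) ∈ V z ∧ 𝒢.d (σ z (𝒢.d x)) = 𝒢.d x := by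
    rintro x z ⟨y, hy, hyx⟩
    rw [← hyx, hσ z y hy]
    exact ⟨hy, rfl⟩
  have heq : ∀ᶠ x in 𝓝 x₀, 𝒢.convFun f g x =
      ∑ z ∈ hF.toFinset, 𝒢.kernel f x (σ z (𝒢.d x)) * g (σ z (𝒢.d x)) := by
    filter_upwards [hW] with x hx
    have hinj : Set.InjOn (fun z => σ z (𝒢.d x)) (hF.toFinset : Set G) := by
      intro a ha b hb hab
      rw [Set.Finite.coe_toFinset] at ha hb
      by_contra hne
      have h1 := (hσV x a (hx.2 a ha)).1.1
      have h2 := (hσV x b (hx.2 b hb)).1.1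
      simp only at hab
      rw [← hab] at h2
      exact Set.disjoint_left.1 (hdisj ha hb hne) h1 h2
    rw [← Finset.sum_image (f := fun y => 𝒢.kernel f x y * g y) hinj]
    refine tsum_eq_sum fun z hz => ?_
    by_cases hdz : 𝒢.d x = 𝒢.d z
    · by_cases hgz : g z = 0
      · rw [hgz, mul_zero]
      exfalso
      apply hz
      have hzs : z ∈ tsupport g := subset_tsupport g hgz
      by_cases hzV' : z ∈ ⋃ z ∈ F, V z
      · simp only [Set.mem_iUnion] at hzV'
        obtain ⟨w, hw, hzw⟩ := hzV'
        refine Finset.mem_image.2 ⟨w, by simpa using hw, ?_⟩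
        rw [hdz]; exact hσ w z hzw
      · exact absurd ⟨z, ⟨hzs, hzV'⟩, hdz.symm⟩ hx.1
    · rw [𝒢.kernel_neg f hdz, zero_mul]
  refine ContinuousAt.congr ?_ (heq.mono fun x hx => hx.symm)
  refine tendsto_finsetSum _ fun z hz => ?_
  have hzF : z ∈ F := by simpa using hz
  have hσc : ContinuousAt (fun x => σ z (𝒢.d x)) x₀ := by
    refine ContinuousAt.comp (g := σ z) ?_ 𝒢.continuous_d.continuousAt
    refine (e z).symm.continuousAt ?_
    rw [OpenPartialHomeomorph.symm_source, ← hzF.2, ← hed' z z]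
    exact (e z).map_source (he z)
  have hev : ∀ᶠ x in 𝓝 x₀, (x, σ z (𝒢.d x)) ∈ {p : G × G | 𝒢.d p.1 = 𝒢.d p.2} := by
    filter_upwards [hW] with x hx
    exact (hσV x z (hx.2 z hzF)).2.symm
  refine Filter.Tendsto.mul ?_ (hg.continuousAt.comp_of_eq hσc rfl)
  exact ((𝒢.continuousOn_kernel hf) (x₀, σ z (𝒢.d x₀)) hev.self_of_nhds).tendsto.comp
    (tendsto_nhdsWithin_iff.2 ⟨(continuousAt_id.prodMk hσc), hev⟩)

theorem hasCompactSupport_convFun [T2Space G] {f g : G → ℂ} (hf : HasCompactSupport f)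
    (hg : HasCompactSupport g) : HasCompactSupport (𝒢.convFun f g) := by
  have : T2Space X := 𝒢.t2Space
  have hcl : IsClosed {p : G × G | 𝒢.d p.1 = 𝒢.r p.2} :=
    isClosed_eq (𝒢.continuous_d.comp continuous_fst) (𝒢.continuous_r.comp continuous_snd)
  have hK := ((hf.isCompact.prod hg.isCompact).inter_right hcl).image_of_continuousOn
    (𝒢.continuousOn_mul.mono Set.inter_subset_right)
  refine HasCompactSupport.intro hK fun x hx => ?_
  rw [TopGroupoid.convFun]
  have hz : ∀ z, 𝒢.kernel f x z * g z = 0 := by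
    intro z
    by_cases hd : 𝒢.d x = 𝒢.d z
    · by_contra hne
      apply hx
      rw [𝒢.kernel_pos f hd] at hne
      refine ⟨(𝒢.mul x (𝒢.inv z), z), ⟨⟨subset_tsupport f (left_ne_zero_of_mul hne),
        subset_tsupport g (right_ne_zero_of_mul hne)⟩, ?_⟩, 𝒢.mul_inv_mul_cancel hd⟩
      change 𝒢.d _ = 𝒢.r _
      rw [𝒢.d_mul _ _ (by rw [𝒢.r_inv, hd]), 𝒢.d_inv]
    · rw [𝒢.kernel_neg f hd, zero_mul]
  simp only [hz, tsum_zero]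

/-- The convolution product on `C_c(G)`. -/
noncomputable def conv [T2Space G] (f g : C_c(G, ℂ)) : C_c(G, ℂ) where
  toFun := 𝒢.convFun f g
  continuous_toFun := 𝒢.continuous_convFun f.continuous g.continuous g.hasCompactSupport'
  hasCompactSupport' := 𝒢.hasCompactSupport_convFun f.hasCompactSupport' g.hasCompactSupport'

/-- The involution on `C_c(G)`. -/
noncomputable def ccStar [T2Space G] (f : C_c(G, ℂ)) : C_c(G, ℂ) where
  toFun := 𝒢.starFun f
  continuous_toFun := continuous_star.comp (f.continuous.comp 𝒢.continuous_inv)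
  hasCompactSupport' := by
    refine HasCompactSupport.intro (f.hasCompactSupport'.isCompact.image 𝒢.continuous_inv)
      fun x hx => ?_
    by_contra hne
    refine hx ⟨𝒢.inv x, subset_tsupport _ fun h => hne ?_, 𝒢.inv_inv x⟩
    change star (f (𝒢.inv x)) = 0
    rw [show f (𝒢.inv x) = 0 from h, star_zero]

theorem exists_kernel_bound (f : C_c(G, ℂ)) : ∃ C : ℝ, 0 ≤ C ∧ ∀ g k, ‖𝒢.kernel f g k‖ ≤ C := by
  obtain ⟨C, hC⟩ := f.hasCompactSupport'.exists_bound_of_continuous f.continuous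
  refine ⟨max C 0, le_max_right _ _, fun g k => ?_⟩
  by_cases h : 𝒢.d g = 𝒢.d k
  · rw [𝒢.kernel_pos _ h]; exact (hC _).trans (le_max_left _ _)
  · rw [𝒢.kernel_neg _ h, norm_zero]; exact le_max_right _ _

theorem exists_kernel_row (f : C_c(G, ℂ)) : ∃ N : ℕ, ∀ g, ∀ F : Finset G,
    (∀ k ∈ F, 𝒢.kernel f g k ≠ 0) → F.card ≤ N := by
  classical
  obtain ⟨N, hN⟩ := 𝒢.exists_card_fiber_r_le f.hasCompactSupport'.isCompact
  refine ⟨N, fun g F hF => ?_⟩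
  have hd : ∀ k ∈ F, 𝒢.d g = 𝒢.d k := fun k hk => by
    by_contra hc; exact hF k hk (𝒢.kernel_neg _ hc)
  rw [← Finset.card_image_of_injOn (s := F) (f := fun k => 𝒢.mul g (𝒢.inv k))]
  · refine hN (𝒢.r g) _ fun h hh => ?_
    obtain ⟨k, hk, rfl⟩ := Finset.mem_image.1 hh
    have := hF k hk
    rw [𝒢.kernel_pos _ (hd k hk)] at this
    exact ⟨subset_tsupport _ this, 𝒢.r_mul _ _ (by rw [𝒢.r_inv, hd k hk])⟩
  · intro a ha b hb hab
    have h := congrArg 𝒢.inv hab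
    simp only [𝒢.inv_mul_inv (hd a ha), 𝒢.inv_mul_inv (hd b hb)] at h
    rw [← 𝒢.mul_inv_mul_cancel (hd a ha).symm, h, 𝒢.mul_inv_mul_cancel (hd b hb).symm]

theorem exists_kernel_col (f : C_c(G, ℂ)) : ∃ N : ℕ, ∀ k, ∀ F : Finset G,
    (∀ g ∈ F, 𝒢.kernel f g k ≠ 0) → F.card ≤ N := by
  classical
  obtain ⟨N, hN⟩ := 𝒢.exists_card_fiber_d_le f.hasCompactSupport'.isCompact
  refine ⟨N, fun k F hF => ?_⟩
  have hd : ∀ g ∈ F, 𝒢.d g = 𝒢.d k := fun g hg => by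
    by_contra hc; exact hF g hg (𝒢.kernel_neg _ hc)
  rw [← Finset.card_image_of_injOn (s := F) (f := fun g => 𝒢.mul g (𝒢.inv k))]
  · refine hN (𝒢.r k) _ fun h hh => ?_
    obtain ⟨g, hg, rfl⟩ := Finset.mem_image.1 hh
    have := hF g hg
    rw [𝒢.kernel_pos _ (hd g hg)] at this
    exact ⟨subset_tsupport _ this, by
      rw [𝒢.d_mul _ _ (by rw [𝒢.r_inv, hd g hg]), 𝒢.d_inv]⟩
  · intro a ha b hb hab
    have h := congrArg (fun t => 𝒢.mul t k) hab
    simpa only [𝒢.mul_inv_mul_cancel (hd a ha), 𝒢.mul_inv_mul_cancel (hd b hb)] using h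

end EtaleGroupoid

/-- The Hilbert space `ℓ²(G)` of the underlying set of `G`. -/
abbrev EllTwo (G : Type*) : Type _ := lp (fun _ : G => ℂ) 2

/-- A bounded matrix with boundedly many nonzero entries in every row and in every column defines
a bounded operator on `ℓ²`. -/
theorem sum_sq_matrix_le {G : Type*} (K : G → G → ℂ) {C : ℝ}
    (hK : ∀ g k, ‖K g k‖ ≤ C) {N M : ℕ}
    (hrow : ∀ g, ∀ F : Finset G, (∀ k ∈ F, K g k ≠ 0) → F.card ≤ N)
    (hcol : ∀ k, ∀ F : Finset G, (∀ g ∈ F, K g k ≠ 0) → F.card ≤ M) (ξ : EllTwo G)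
    (s : Finset G) : ∑ g ∈ s, ‖∑' k, K g k * ξ k‖ ^ (2 : ℝ≥0∞).toReal ≤
      (C * √(N * M) * ‖ξ‖) ^ (2 : ℝ≥0∞).toReal := by
  classical
  have hfin : ∀ g, {k | K g k ≠ 0}.Finite := by
    intro g
    by_contra hinf
    obtain ⟨F, hF, hc⟩ := (show Set.Infinite _ from hinf).exists_subset_card_eq (N + 1)
    have := hrow g F (fun h hh => hF hh)
    omega
  set S : G → Finset G := fun g => (hfin g).toFinset
  have hS : ∀ g k, k ∈ S g ↔ K g k ≠ 0 := fun g k => by simp [S]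
  have hsum : ∀ g, ∑' k, K g k * ξ k = ∑ k ∈ S g, K g k * ξ k := fun g =>
    tsum_eq_sum fun k hk => by
      rw [hS, not_not] at hk; rw [hk, zero_mul]
  have h1 : ∀ g, ‖∑' k, K g k * ξ k‖ ^ 2 ≤ C ^ 2 * N * ∑ k ∈ S g, ‖ξ k‖ ^ 2 := by
    intro g
    have a1 : ‖∑' k, K g k * ξ k‖ ≤ C * ∑ k ∈ S g, ‖ξ k‖ := by
      rw [hsum, Finset.mul_sum]
      refine (norm_sum_le _ _).trans (Finset.sum_le_sum fun k _ => ?_)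
      rw [norm_mul]
      exact mul_le_mul_of_nonneg_right (hK g k) (norm_nonneg _)
    have a2 : (∑ k ∈ S g, ‖ξ k‖) ^ 2 ≤ N * ∑ k ∈ S g, ‖ξ k‖ ^ 2 := by
      refine (sq_sum_le_card_mul_sum_sq).trans ?_
      refine mul_le_mul_of_nonneg_right ?_ (Finset.sum_nonneg fun _ _ => sq_nonneg _)
      exact_mod_cast hrow g (S g) (fun k hk => (hS g k).1 hk)
    calc ‖∑' k, K g k * ξ k‖ ^ 2 ≤ (C * ∑ k ∈ S g, ‖ξ k‖) ^ 2 :=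
          pow_le_pow_left₀ (norm_nonneg _) a1 2
      _ = C ^ 2 * (∑ k ∈ S g, ‖ξ k‖) ^ 2 := by ring
      _ ≤ C ^ 2 * (N * ∑ k ∈ S g, ‖ξ k‖ ^ 2) := by gcongr
      _ = _ := by ring
  have h2 : ∑ g ∈ s, ∑ k ∈ S g, ‖ξ k‖ ^ 2 ≤ M * ‖ξ‖ ^ 2 := by
    have b1 : ∀ g ∈ s, ∑ k ∈ S g, ‖ξ k‖ ^ 2 =
        ∑ k ∈ s.biUnion S, if K g k ≠ 0 then ‖ξ k‖ ^ 2 else 0 := by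
      intro g hg
      rw [← Finset.sum_filter]
      refine Finset.sum_congr ?_ fun _ _ => rfl
      ext k
      simp only [Finset.mem_filter, Finset.mem_biUnion, hS]
      exact ⟨fun h => ⟨⟨g, hg, h⟩, h⟩, fun h => h.2⟩
    rw [Finset.sum_congr rfl b1, Finset.sum_comm]
    have b2 : ∀ k, (∑ g ∈ s, if K g k ≠ 0 then ‖ξ k‖ ^ 2 else 0) ≤ M * ‖ξ k‖ ^ 2 := by
      intro k
      rw [← Finset.sum_filter, Finset.sum_const, nsmul_eq_mul]
      refine mul_le_mul_of_nonneg_right ?_ (sq_nonneg _)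
      exact_mod_cast hcol k _ fun g hg => (Finset.mem_filter.1 hg).2
    refine (Finset.sum_le_sum fun k _ => b2 k).trans ?_
    rw [← Finset.mul_sum]
    refine mul_le_mul_of_nonneg_left ?_ (Nat.cast_nonneg _)
    have := lp.sum_rpow_le_norm_rpow (p := 2) (by norm_num) ξ (s.biUnion S)
    simpa using this
  simp only [ENNReal.toReal_ofNat, Real.rpow_ofNat]
  calc ∑ g ∈ s, ‖∑' k, K g k * ξ k‖ ^ 2
      ≤ ∑ g ∈ s, C ^ 2 * N * ∑ k ∈ S g, ‖ξ k‖ ^ 2 := Finset.sum_le_sum fun g _ => h1 g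
    _ = C ^ 2 * N * ∑ g ∈ s, ∑ k ∈ S g, ‖ξ k‖ ^ 2 := by rw [Finset.mul_sum]
    _ ≤ C ^ 2 * N * (M * ‖ξ‖ ^ 2) := by gcongr
    _ = _ := by
      rw [mul_pow, mul_pow, Real.sq_sqrt (by positivity)]; ring

/-- Two bounded operators on `ℓ²(G)` with the same matrix coefficients are equal. -/
theorem ellTwo_clm_ext {G : Type*} [DecidableEq G] {S T : EllTwo G →L[ℂ] EllTwo G}
    (h : ∀ g k, (S (lp.single 2 k (1 : ℂ)) : EllTwo G) g = (T (lp.single 2 k (1 : ℂ)) : EllTwo G) g) :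
    S = T := by
  have hk : ∀ k, S (lp.single 2 k (1 : ℂ)) = T (lp.single 2 k (1 : ℂ)) := fun k =>
    lp.ext (funext fun g => h g k)
  ext1 ξ
  have hξ := lp.hasSum_single (p := 2) (by norm_num) ξ
  have e : ∀ k, S (lp.single 2 k (ξ k)) = T (lp.single 2 k (ξ k)) := by
    intro k
    have : (lp.single 2 k (ξ k) : EllTwo G) = ξ k • lp.single 2 k (1 : ℂ) := by
      rw [← lp.single_smul, smul_eq_mul, mul_one]
    rw [this, map_smul, map_smul, hk]
  have h1 := hξ.mapL S
  have h2 := hξ.mapL T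
  simp only [e] at h1
  exact h1.unique h2

namespace EtaleGroupoid

variable {X G : Type*} [TopologicalSpace X] [TopologicalSpace G] (𝒢 : EtaleGroupoid X G)

theorem kernel_summable (f : C_c(G, ℂ)) (g : G) (ξ : G → ℂ) :
    Summable fun k => 𝒢.kernel f g k * ξ k := by
  obtain ⟨N, hN⟩ := 𝒢.exists_kernel_row f
  refine summable_of_hasFiniteSupport ?_
  by_contra hinf
  obtain ⟨F, hF, hc⟩ := (show Set.Infinite _ from hinf).exists_subset_card_eq (N + 1)
  have := hN g F (fun h hh => left_ne_zero_of_mul (hF hh))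
  omega

theorem exists_regRep_bound (f : C_c(G, ℂ)) : ∃ C : ℝ, 0 ≤ C ∧ ∀ (ξ : EllTwo G) (s : Finset G),
    ∑ g ∈ s, ‖∑' k, 𝒢.kernel f g k * ξ k‖ ^ (2 : ℝ≥0∞).toReal ≤
      (C * ‖ξ‖) ^ (2 : ℝ≥0∞).toReal := by
  obtain ⟨C, hC, hK⟩ := 𝒢.exists_kernel_bound f
  obtain ⟨N, hN⟩ := 𝒢.exists_kernel_row f
  obtain ⟨M, hM⟩ := 𝒢.exists_kernel_col f
  exact ⟨C * √(N * M), by positivity, sum_sq_matrix_le _ hK hN hM⟩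

/-- The left regular representation of `C_c(G)`, which is the direct sum of the representations
`π_x` on `ℓ²(d⁻¹(x))` over all objects `x`:
`(f ξ)(g) = ∑ f (g k⁻¹) ξ k`, where `k` ranges over the arrows with `d k = d g`. -/
noncomputable def regRep (f : C_c(G, ℂ)) : EllTwo G →L[ℂ] EllTwo G :=
  LinearMap.mkContinuousOfExistsBound
    { toFun := fun ξ => ⟨fun g => ∑' k, 𝒢.kernel f g k * ξ k, by
        obtain ⟨C, -, hC⟩ := 𝒢.exists_regRep_bound f
        exact memℓp_gen' (hC ξ)⟩
      map_add' := fun ξ η => by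
        ext g
        change ∑' k, 𝒢.kernel f g k * (ξ + η : EllTwo G) k =
          (∑' k, 𝒢.kernel f g k * ξ k) + ∑' k, 𝒢.kernel f g k * η k
        rw [← (𝒢.kernel_summable f g ξ).tsum_add (𝒢.kernel_summable f g η)]
        exact tsum_congr fun k => by rw [lp.coeFn_add, Pi.add_apply, mul_add]
      map_smul' := fun c ξ => by
        ext g
        change ∑' k, 𝒢.kernel f g k * (c • ξ : EllTwo G) k = c * ∑' k, 𝒢.kernel f g k * ξ k
        rw [← tsum_mul_left]
        exact tsum_congr fun k => by
          rw [lp.coeFn_smul, Pi.smul_apply, smul_eq_mul, mul_left_comm] }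
    (by
      obtain ⟨C, hC0, hC⟩ := 𝒢.exists_regRep_bound f
      exact ⟨C, fun ξ => lp.norm_le_of_forall_sum_le (by norm_num) (by positivity) (hC ξ)⟩)

theorem regRep_apply (f : C_c(G, ℂ)) (ξ : EllTwo G) (g : G) :
    𝒢.regRep f ξ g = ∑' k, 𝒢.kernel f g k * ξ k := rfl

open Classical in
theorem regRep_single (f : C_c(G, ℂ)) (g k : G) :
    𝒢.regRep f (lp.single 2 k (1 : ℂ)) g = 𝒢.kernel f g k := by
  rw [regRep_apply, tsum_eq_single k]
  · rw [lp.single_apply_self, mul_one]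
  · intro l hl
    rw [lp.single_apply_ne _ _ _ hl, mul_zero]

theorem kernel_add (f f' : C_c(G, ℂ)) (g k : G) :
    𝒢.kernel (f + f') g k = 𝒢.kernel f g k + 𝒢.kernel f' g k := by
  by_cases h : 𝒢.d g = 𝒢.d k
  · simp only [𝒢.kernel_pos _ h]; rfl
  · simp only [𝒢.kernel_neg _ h, add_zero]

theorem kernel_smul (c : ℂ) (f : C_c(G, ℂ)) (g k : G) :
    𝒢.kernel (c • f) g k = c * 𝒢.kernel f g k := by
  by_cases h : 𝒢.d g = 𝒢.d k
  · simp only [𝒢.kernel_pos _ h]; rfl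
  · simp only [𝒢.kernel_neg _ h, mul_zero]

theorem regRep_add (f f' : C_c(G, ℂ)) : 𝒢.regRep (f + f') = 𝒢.regRep f + 𝒢.regRep f' := by
  classical
  refine ellTwo_clm_ext fun g k => ?_
  rw [add_apply, lp.coeFn_add, Pi.add_apply, regRep_single, regRep_single,
    regRep_single]
  exact 𝒢.kernel_add f f' g k

theorem regRep_smul (c : ℂ) (f : C_c(G, ℂ)) : 𝒢.regRep (c • f) = c • 𝒢.regRep f := by
  classical
  refine ellTwo_clm_ext fun g k => ?_
  rw [smul_apply, lp.coeFn_smul, Pi.smul_apply, regRep_single, regRep_single]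
  exact 𝒢.kernel_smul c f g k

theorem regRep_zero : 𝒢.regRep 0 = 0 := by
  have h := 𝒢.regRep_smul 0 0
  rwa [zero_smul, zero_smul] at h

theorem regRep_conv [T2Space G] (f g : C_c(G, ℂ)) :
    𝒢.regRep (𝒢.conv f g) = 𝒢.regRep f * 𝒢.regRep g := by
  classical
  refine ellTwo_clm_ext fun x l => ?_
  rw [mul_apply_eq_comp, regRep_single, regRep_apply]
  refine (𝒢.kernel_convFun f g x l).trans (tsum_congr fun k => ?_)
  rw [regRep_single]

theorem regRep_ccStar [T2Space G] (f : C_c(G, ℂ)) :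
    𝒢.regRep (𝒢.ccStar f) = star (𝒢.regRep f) := by
  classical
  refine ellTwo_clm_ext fun g k => ?_
  rw [regRep_single]
  refine (𝒢.kernel_starFun f g k).trans ?_
  rw [← regRep_single]
  have h := ContinuousLinearMap.adjoint_inner_right (𝒢.regRep f)
    (lp.single 2 g (1 : ℂ)) (lp.single 2 k (1 : ℂ))
  rw [lp.inner_single_left, lp.inner_single_right] at h
  simp only [RCLike.inner_apply, map_one, mul_one, one_mul] at h
  rw [ContinuousLinearMap.star_eq_adjoint, h]
  rfl

/-- The image of the convolution algebra `C_c(G)` under the regular representation. -/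
noncomputable def convAlgebra [T2Space G] :
    NonUnitalStarSubalgebra ℂ (EllTwo G →L[ℂ] EllTwo G) where
  carrier := Set.range 𝒢.regRep
  zero_mem' := ⟨0, 𝒢.regRep_zero⟩
  add_mem' := by
    rintro _ _ ⟨f, rfl⟩ ⟨g, rfl⟩
    exact ⟨f + g, 𝒢.regRep_add f g⟩
  smul_mem' := by
    rintro c _ ⟨f, rfl⟩
    exact ⟨c • f, 𝒢.regRep_smul c f⟩
  mul_mem' := by
    rintro _ _ ⟨f, rfl⟩ ⟨g, rfl⟩
    exact ⟨𝒢.conv f g, 𝒢.regRep_conv f g⟩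
  star_mem' := by
    rintro _ ⟨f, rfl⟩
    exact ⟨𝒢.ccStar f, 𝒢.regRep_ccStar f⟩

/-- The reduced C*-algebra `C_r^*(G)`: the completion of `C_c(G)` in the norm of the regular
representation, realized as the closure of the image of `C_c(G)`. -/
noncomputable abbrev ReducedCStar [T2Space G] :
    NonUnitalStarSubalgebra ℂ (EllTwo G →L[ℂ] EllTwo G) :=
  (𝒢.convAlgebra).topologicalClosure

instance [T2Space G] : IsClosed (𝒢.ReducedCStar : Set (EllTwo G →L[ℂ] EllTwo G)) :=
  NonUnitalStarSubalgebra.isClosed_topologicalClosure _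

open Classical in
/-- The function on `G` that corresponds to an element of the reduced C*-algebra.  On
`regRep f` it takes the value `f`. -/
noncomputable def toFunction (T : EllTwo G →L[ℂ] EllTwo G) (g : G) : ℂ :=
  T (lp.single 2 (𝒢.u (𝒢.d g)) (1 : ℂ)) g

theorem toFunction_regRep (f : C_c(G, ℂ)) : 𝒢.toFunction (𝒢.regRep f) = f :=
  funext fun g => (𝒢.regRep_single f g _).trans (𝒢.kernel_u f g)

theorem dist_toFunction_le (S T : EllTwo G →L[ℂ] EllTwo G) (g : G) :
    dist (𝒢.toFunction S g) (𝒢.toFunction T g) ≤ dist S T := by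
  classical
  rw [dist_eq_norm, dist_eq_norm]
  have h : 𝒢.toFunction S g - 𝒢.toFunction T g =
      (S - T) (lp.single 2 (𝒢.u (𝒢.d g)) (1 : ℂ)) g := by
    rw [sub_apply, lp.coeFn_sub, Pi.sub_apply, toFunction, toFunction]
  rw [h]
  refine (lp.norm_apply_le_norm (by norm_num) _ _).trans ?_
  refine ((S - T).le_opNorm _).trans ?_
  rw [lp.norm_single (by norm_num), norm_one, mul_one]

theorem continuous_toFunction [T2Space G] (T : 𝒢.ReducedCStar) :
    Continuous (𝒢.toFunction (T : EllTwo G →L[ℂ] EllTwo G)) := by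
  refine continuous_of_uniform_approx_of_continuous fun U hU => ?_
  obtain ⟨ε, hε, hεU⟩ := Metric.mem_uniformity_dist.1 hU
  obtain ⟨_, ⟨f, rfl⟩, hf⟩ := Metric.mem_closure_iff.1 T.2 ε hε
  refine ⟨f, f.continuous, fun g => hεU ?_⟩
  rw [← 𝒢.toFunction_regRep f]
  exact (𝒢.dist_toFunction_le _ _ g).trans_lt hf

/-- The measurement space `ms(G)`: the lattice of open sets of arrows, with the Scott topology and
with pointwise product and involution. -/
def MS (_𝒢 : EtaleGroupoid X G) : Type _ := TopologicalSpace.Opens G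

namespace MS

instance : CompleteLattice 𝒢.MS := inferInstanceAs (CompleteLattice (TopologicalSpace.Opens G))

instance : SetLike 𝒢.MS G := inferInstanceAs (SetLike (TopologicalSpace.Opens G) G)

instance : TopologicalSpace 𝒢.MS := Topology.scott 𝒢.MS Set.univ

/-- The pointwise product of open sets of arrows. -/
instance : Mul 𝒢.MS where
  mul U V := ⟨{x | ∃ g ∈ U, ∃ h ∈ V, 𝒢.d g = 𝒢.r h ∧ 𝒢.mul g h = x}, by
    rw [isOpen_iff_mem_nhds]
    rintro _ ⟨g, hg, h, hh, hgh, rfl⟩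
    have hc : ContinuousWithinAt (fun p : G × G => 𝒢.mul p.1 (𝒢.inv p.2))
        {p | 𝒢.d p.1 = 𝒢.d p.2} (𝒢.mul g h, h) := by
      refine 𝒢.continuousOn_mul.comp (f := fun p : G × G => (p.1, 𝒢.inv p.2))
        (continuous_fst.prodMk (𝒢.continuous_inv.comp continuous_snd)).continuousOn ?_ _
        (𝒢.d_mul g h hgh)
      intro p hp
      simpa [𝒢.r_inv] using hp
    have hU : (U : Set G) ∈ 𝓝 (𝒢.mul (𝒢.mul g h) (𝒢.inv h)) := by
      rw [𝒢.mul_mul_inv_cancel hgh]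
      exact U.isOpen.mem_nhds hg
    have h1 := mem_nhdsWithin_iff_exists_mem_nhds_inter.1 (hc hU)
    obtain ⟨W, hW, hWU⟩ := h1
    obtain ⟨A, hA, B, hB, hAB⟩ := mem_nhds_prod_iff.1 hW
    have hB' : 𝒢.d '' (B ∩ V) ∈ 𝓝 (𝒢.d (𝒢.mul g h)) := by
      rw [𝒢.d_mul g h hgh]
      exact 𝒢.isLocalHomeomorph_d.isOpenMap.image_mem_nhds
        (Filter.inter_mem hB (V.isOpen.mem_nhds hh))
    filter_upwards [hA, 𝒢.continuous_d.continuousAt hB'] with x hx hx'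
    obtain ⟨k, ⟨hkB, hkV⟩, hk⟩ := hx'
    have hm : (x, k) ∈ W ∩ {p : G × G | 𝒢.d p.1 = 𝒢.d p.2} := ⟨hAB ⟨hx, hkB⟩, hk.symm⟩
    refine ⟨𝒢.mul x (𝒢.inv k), hWU hm, k, hkV, ?_,
      𝒢.mul_inv_mul_cancel hk.symm⟩
    rw [𝒢.d_mul _ _ (by rw [𝒢.r_inv, hk]), 𝒢.d_inv]⟩

/-- The pointwise involution: `U* = {g⁻¹ | g ∈ U}`. -/
instance : Star 𝒢.MS where
  star U := ⟨{g | 𝒢.inv g ∈ U}, U.isOpen.preimage 𝒢.continuous_inv⟩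

/-- The unit `e` is the set of all identity arrows. -/
instance : One 𝒢.MS where
  one := ⟨Set.range 𝒢.u, by
    refine (IsLocalHomeomorph.isOpenMap ?_).isOpen_range
    refine IsLocalHomeomorph.of_comp (g := 𝒢.d) ?_ 𝒢.isLocalHomeomorph_d 𝒢.continuous_u
    rw [show 𝒢.d ∘ 𝒢.u = id from funext 𝒢.d_u]
    exact (Homeomorph.refl X).isLocalHomeomorph⟩

end MS

end EtaleGroupoid

/-- `Max A`: the closed linear subspaces of the C*-algebra `A`, ordered by inclusion. -/
def MaxSpace (A : Type*) [NonUnitalCStarAlgebra A] : Type _ := ClosedSubmodule ℂ A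

namespace MaxSpace

variable (A : Type*) [NonUnitalCStarAlgebra A]

noncomputable instance : CompleteLattice (MaxSpace A) :=
  inferInstanceAs (CompleteLattice (ClosedSubmodule ℂ A))

instance : SetLike (MaxSpace A) A := inferInstanceAs (SetLike (ClosedSubmodule ℂ A) A)

/-- The lower Vietoris topology. -/
instance : TopologicalSpace (MaxSpace A) :=
  TopologicalSpace.generateFrom
    {𝒰 | ∃ U : Set A, IsOpen U ∧ 𝒰 = {P : MaxSpace A | ((P : Set A) ∩ U).Nonempty}}

/-- `P Q` is the closed linear span of the products `a b` with `a ∈ P` and `b ∈ Q`. -/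
noncomputable instance : Mul (MaxSpace A) where
  mul P Q := (Submodule.span ℂ {c : A | ∃ a ∈ P, ∃ b ∈ Q, a * b = c}).closure

/-- The pointwise involution: `P* = {a* | a ∈ P}`. -/
instance : Star (MaxSpace A) where
  star P := ⟨
    { carrier := {a : A | star a ∈ P}
      add_mem' := fun {a b} ha hb => by
        change star (a + b) ∈ P.toSubmodule
        rw [star_add]
        exact P.toSubmodule.add_mem ha hb
      zero_mem' := by
        change star (0 : A) ∈ P.toSubmodule
        rw [star_zero]
        exact P.toSubmodule.zero_mem
      smul_mem' := fun c a ha => by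
        change star (c • a) ∈ P.toSubmodule
        rw [star_smul]
        exact P.toSubmodule.smul_mem _ ha },
    P.isClosed'.preimage continuous_star⟩

end MaxSpace

namespace EtaleGroupoid

variable {X G : Type*} [TopologicalSpace X] [TopologicalSpace G] [T2Space G]
  (𝒢 : EtaleGroupoid X G)

/-- The embedding of the associated observer sends an open set `U` to the closure in `C_r^*(G)` of
`C_c(U)`, the functions in `C_c(G)` whose support is contained in `U`. -/
noncomputable def assocEmb (U : 𝒢.MS) : MaxSpace 𝒢.ReducedCStar :=
  Submodule.closure
    { carrier := {T : 𝒢.ReducedCStar | ∃ f : C_c(G, ℂ), tsupport f ⊆ U ∧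
        (T : EllTwo G →L[ℂ] EllTwo G) = 𝒢.regRep f}
      add_mem' := by
        rintro S T ⟨f, hf, hS⟩ ⟨g, hg, hT⟩
        refine ⟨f + g, (tsupport_add f g).trans (Set.union_subset hf hg), ?_⟩
        rw [regRep_add, ← hS, ← hT]
        rfl
      zero_mem' := by
        refine ⟨0, ?_, 𝒢.regRep_zero.symm⟩
        rw [CompactlySupportedContinuousMap.coe_zero, tsupport_zero]
        exact Set.empty_subset _
      smul_mem' := by
        rintro c T ⟨f, hf, hT⟩
        refine ⟨c • f, (tsupport_smul_subset_right (fun _ => c) f).trans hf, ?_⟩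
        rw [regRep_smul, ← hT]
        rfl }

/-- The retraction of the associated observer sends a closed subspace to the union of the open
supports of its elements. -/
noncomputable def assocRet (P : MaxSpace 𝒢.ReducedCStar) : 𝒢.MS :=
  ⟨⋃ T ∈ P, {g | 𝒢.toFunction (T : EllTwo G →L[ℂ] EllTwo G) g ≠ 0},
    isOpen_biUnion fun T _ => isOpen_ne_fun (𝒢.continuous_toFunction T) continuous_const⟩

end EtaleGroupoid

/-- A sober lattice: a sober space `L` whose specialization order (this is the given order, see
`le_iff`) has a least element and binary joins, and the binary join is continuous. -/
structure IsSoberLattice (L : Type*) [SemilatticeSup L] [OrderBot L] [TopologicalSpace L] :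
    Prop where
  t0 : T0Space L
  quasiSober : QuasiSober L
  le_iff : ∀ x y : L, x ≤ y ↔ ∀ U : Set L, IsOpen U → x ∈ U → y ∈ U
  continuous_sup : Continuous fun p : L × L => p.1 ⊔ p.2

/-- A homomorphism of sober lattices. -/
structure IsSoberLatticeHom {L M : Type*} [SemilatticeSup L] [OrderBot L] [TopologicalSpace L]
    [SemilatticeSup M] [OrderBot M] [TopologicalSpace M] (f : L → M) : Prop where
  continuous : Continuous f
  map_sup : ∀ x y, f (x ⊔ y) = f x ⊔ f y
  map_bot : f ⊥ = ⊥

/-- A measurement space. -/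
structure IsMeasurementSpace (M : Type*) [SemilatticeSup M] [OrderBot M] [TopologicalSpace M]
    [Mul M] [Star M] : Prop extends IsSoberLattice M where
  continuous_mul : Continuous fun p : M × M => p.1 * p.2
  continuous_star : Continuous (star : M → M)
  mul_assoc : ∀ m n k : M, m * n * k = m * (n * k)
  mul_bot : ∀ m : M, m * ⊥ = ⊥
  mul_sup : ∀ m n k : M, m * (n ⊔ k) = m * n ⊔ m * k
  star_star : ∀ m : M, star (star m) = m
  star_mul : ∀ m n : M, star (m * n) = star n * star m
  stablyGelfand : ∀ m : M, m * star m * m ≤ m → m ≤ m * star m * m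

/-- A homomorphism of measurement spaces. -/
structure IsMeasurementSpaceHom {M N : Type*}
    [SemilatticeSup M] [OrderBot M] [TopologicalSpace M] [Mul M] [Star M]
    [SemilatticeSup N] [OrderBot N] [TopologicalSpace N] [Mul N] [Star N]
    (f : M → N) : Prop extends IsSoberLatticeHom f where
  map_mul : ∀ x y, f (x * y) = f x * f y
  map_star : ∀ x, f (star x) = star (f x)

/-- `x` is way below `y`. -/
def IsWayBelow {L : Type*} [CompleteLattice L] (x y : L) : Prop :=
  ∀ D : Set L, D.Nonempty → DirectedOn (· ≤ ·) D → y ≤ sSup D → ∃ z ∈ D, x ≤ z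

/-- A space of classical measurements: a countably-based locally compact locale (that is, a
countably-based continuous lattice which is a locale), with the Scott topology. -/
structure IsSpaceOfClassicalMeasurements (L : Type*) [CompleteLattice L] [TopologicalSpace L] :
    Prop extends IsSoberLattice L where
  isScott : Topology.IsScott L Set.univ
  inf_sSup : ∀ (x : L) (S : Set L), x ⊓ sSup S = ⨆ y ∈ S, x ⊓ y
  continuousLattice : ∀ x : L, sSup {y | IsWayBelow y x} = x
  countablyBased : ∃ B : Set L, B.Countable ∧ ∀ x : L, sSup {b ∈ B | IsWayBelow b x} = x

/-- A classical measurement space. -/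
structure IsClassicalMeasurementSpace (M : Type*) [CompleteLattice M] [TopologicalSpace M]
    [Mul M] [Star M] : Prop extends IsMeasurementSpace M, IsSpaceOfClassicalMeasurements M where
  le_mul_star_mul : ∀ m : M, m ≤ m * star m * m

/-- The set `I(Q)` of partial units of a unital involutive quantale. -/
def partialUnits (Q : Type*) [LE Q] [Mul Q] [Star Q] [One Q] : Set Q :=
  {s | s * star s ≤ 1 ∧ star s * s ≤ 1}

/-- The set `I_b(Q)` for a projection `b`. -/
def partialUnitsAt {Q : Type*} [LE Q] [Mul Q] [Star Q] (b : Q) : Set Q :=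
  {s | s * star s ≤ b ∧ star s * s ≤ b ∧ s * b ≤ s ∧ b * s ≤ s}

/-- An inverse quantal frame: a unital stably Gelfand quantale which is also a locale and whose top
element is the join of the partial units. -/
structure IsInverseQuantalFrame (Q : Type*) [CompleteLattice Q] [Mul Q] [Star Q] [One Q] :
    Prop where
  mul_assoc : ∀ a b c : Q, a * b * c = a * (b * c)
  mul_sSup : ∀ (a : Q) (S : Set Q), a * sSup S = ⨆ b ∈ S, a * b
  sSup_mul : ∀ (S : Set Q) (b : Q), sSup S * b = ⨆ a ∈ S, a * b
  one_mul : ∀ a : Q, 1 * a = a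
  mul_one : ∀ a : Q, a * 1 = a
  star_star : ∀ a : Q, star (star a) = a
  star_mul : ∀ a b : Q, star (a * b) = star b * star a
  star_sSup : ∀ S : Set Q, star (sSup S) = ⨆ a ∈ S, star a
  stablyGelfand : ∀ a : Q, a * star a * a ≤ a → a ≤ a * star a * a
  inf_sSup : ∀ (a : Q) (S : Set Q), a ⊓ sSup S = ⨆ b ∈ S, a ⊓ b
  top_eq : (⊤ : Q) = sSup (partialUnits Q)

section Observers

variable {M O : Type*}

/-- `(O, (emb, ret))` is an observer of `M`; that is, `(emb, ret)` is an observer map from `M` to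
`O`. -/
structure IsObserver [SemilatticeSup M] [OrderBot M] [TopologicalSpace M] [Mul M] [Star M]
    [SemilatticeSup O] [OrderBot O] [TopologicalSpace O] [Mul O] [Star O]
    (emb : O → M) (ret : M → O) : Prop where
  measurementSpace : IsMeasurementSpace M
  measurementSpace' : IsMeasurementSpace O
  emb_hom : IsMeasurementSpaceHom emb
  ret_hom : IsSoberLatticeHom ret
  ret_emb : ∀ w, ret (emb w) = w
  ret_star : ∀ m, ret (star m) = star (ret m)
  ret_mul_emb : ∀ m w, ret (m * emb w) = ret m * w

/-- A persistent observer. -/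
structure IsPersistentObserver
    [SemilatticeSup M] [OrderBot M] [TopologicalSpace M] [Mul M] [Star M]
    [SemilatticeSup O] [OrderBot O] [TopologicalSpace O] [Mul O] [Star O]
    (emb : O → M) (ret : M → O) : Prop extends IsObserver emb ret where
  persistent : ∀ m w n, ret (m * emb w * n) = ret m * w * ret n

/-- An étale observer. -/
structure IsEtaleObserver
    [SemilatticeSup M] [OrderBot M] [TopologicalSpace M] [Mul M] [Star M]
    [CompleteLattice O] [TopologicalSpace O] [Mul O] [Star O] [One O]
    (emb : O → M) (ret : M → O) : Prop extends IsObserver emb ret where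
  classical : IsClassicalMeasurementSpace O
  inverseQuantalFrame : IsInverseQuantalFrame O
  etale : ∀ m w n, ret m ∈ partialUnits O → ret n ∈ partialUnits O →
    ret m * w * ret n ≤ ret (m * emb w * n)

/-- An `I`-stable observer: an étale observer whose retraction sends `I_b(M)` to `I(O)`, where `b`
is the image of the unit. -/
structure IsIStableObserver
    [SemilatticeSup M] [OrderBot M] [TopologicalSpace M] [Mul M] [Star M]
    [CompleteLattice O] [TopologicalSpace O] [Mul O] [Star O] [One O]
    (emb : O → M) (ret : M → O) : Prop extends IsEtaleObserver emb ret where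
  istable : ∀ s ∈ partialUnitsAt (emb 1), ret s ∈ partialUnits O

end Observers

/-! The two measurement spaces are treated separately. In `Max A` every verification reduces to
generators, because the set of elements satisfying a linear and continuous condition is again a
closed subspace. The one analytic axiom is stable Gelfandness: the elements `a (1 - c a*a)ⁿ` tend to
`0`, and each differs from `a` by an element of `P P* P` (`MaxSpace.stablyGelfand`). In `ms(G)` the
product is computed arrow by arrow, and `g = g g⁻¹ g` gives the Gelfand property at once; local
compactness makes the Scott topology manageable, since a map into it is continuous as soon as
membership of an arrow is an open condition (`MS.continuous_of_eventually`).

The link between them is that an element of the reduced algebra is determined by its coefficient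
function, and products are convolutions even outside `C_c(G)` (`hasSum_coeff_mul`). If one factor is
supported in an open bisection, at most one term of the convolution survives, so values multiply
without cancellation. Bump functions on bisections therefore give `ρ(m ι(ω)) = ρ(m) ω`, and they
also factor functions on a product of open sets, so that `ι` is multiplicative
(`ofCc_mem_mul_of_injOn`). The étale inequality follows from the same principle, as a partial unit
has at most one arrow over each object.

Persistence asks whether cancellation can be avoided between two arbitrary subspaces by inserting a
function. When orbits are discrete, a bump can be confined to arrows whose range is one prescribed
point of the orbit, and triviality of isotropy then leaves a single term. Conversely, a nontrivial
isotropy arrow `g` at `x` gives elements `T`, `S` with values `1, 1` and `1, -1` at the unit of `x`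
and at `g`; the two terms of `T f S` at `g` cancel for every `f` supported on the units.

For `I`-stability, a nonunit arrow in `ρ(P) ρ(P)*` can be moved to one whose domain has trivial
isotropy, since the nonunits form an open set. There the terms of the convolution have distinct
ranges, so functions supported on the units separate any term from finitely many others, and
summability controls the rest (`eq_zero_of_forall_hasSum_mul`). Each term must then vanish, a
contradiction (`assocRet_mul_star_le_one`). -/

/-! ### Functional calculus for the Gelfand property -/

section Gelfand

/-- In a C*-algebra, `a (1 - a* a / c)ⁿ` is small for large `n` if `c = ‖a* a‖`. -/
theorem norm_sq_mul_one_sub_pow_le {B : Type*} [CStarAlgebra B] (a : B) (n : ℕ)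
    (hn : 0 < n) :
    ‖a * (1 - (‖star a * a‖⁻¹ : ℝ) • (star a * a)) ^ n‖ ^ 2 ≤ ‖star a * a‖ / n := by
  rcases eq_or_ne a 0 with rfl | ha
  · simp
  have : Nontrivial B := ⟨a, 0, ha⟩
  let : PartialOrder B := CStarAlgebra.spectralOrder B
  have : StarOrderedRing B := CStarAlgebra.spectralOrderedRing B
  set h := star a * a with hh
  set c := ‖h‖ with hc
  have hh0 : 0 ≤ h := star_mul_self_nonneg a
  have hsa : IsSelfAdjoint h := hh0.isSelfAdjoint
  have hc0 : 0 < c := by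
    rw [hc, hh, CStarRing.norm_star_mul_self]
    exact mul_pos (norm_pos_iff.2 ha) (norm_pos_iff.2 ha)
  set k := (1 - (c⁻¹ : ℝ) • h) with hk
  have hksa : star k = k := by
    rw [hk, star_sub, star_one, star_smul, hsa.star_eq, star_trivial]
  -- By the C*-identity, the squared norm is that of the function `t (1 - t/c)²ⁿ` of `h = a*a`, to
  -- be bounded on the spectrum, which lies in `[0, c]`.
  have e1 : star (a * k ^ n) * (a * k ^ n) = k ^ n * h * k ^ n := by
    rw [star_mul, star_pow, hksa, hh]; simp only [mul_assoc]
  have e2 : k ^ n * h * k ^ n =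
      cfc (fun t : ℝ => (1 - c⁻¹ * t) ^ n * t * (1 - c⁻¹ * t) ^ n) h := by
    have c1 : ContinuousOn (fun t : ℝ => 1 - c⁻¹ * t) (spectrum ℝ h) := by fun_prop
    have hkc : cfc (fun t : ℝ => 1 - c⁻¹ * t) h = k := by
      rw [cfc_sub (fun _ => 1) _ h, cfc_const_one ℝ h, cfc_const_mul_id _ h]
    have hkn : cfc (fun t : ℝ => (1 - c⁻¹ * t) ^ n) h = k ^ n := by
      rw [cfc_pow _ n h c1, hkc]
    rw [cfc_mul (fun t : ℝ => (1 - c⁻¹ * t) ^ n * t) (fun t : ℝ => (1 - c⁻¹ * t) ^ n) h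
      ((c1.pow n).mul continuousOn_id) (c1.pow n), cfc_mul (fun t : ℝ => (1 - c⁻¹ * t) ^ n) (fun t => t) h (c1.pow n)
      continuousOn_id, hkn,
      cfc_id' ℝ h]
  rw [sq, ← CStarRing.norm_star_mul_self, e1, e2]
  refine norm_cfc_le (by positivity) fun t ht => ?_
  have ht0 : 0 ≤ t := spectrum_nonneg_of_nonneg hh0 ht
  have htc : t ≤ c := (Real.le_norm_self t).trans (spectrum.norm_le_norm_of_mem ht)
  set s := c⁻¹ * t with hs
  have hs0 : 0 ≤ s := by positivity
  have hs1 : s ≤ 1 := by rw [hs, inv_mul_le_iff₀ hc0]; simpa using htc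
  have hts : t = c * s := by rw [hs]; field_simp
  have hp0 : 0 ≤ (1 - s) ^ n := pow_nonneg (by linarith) n
  have hp1 : (1 - s) ^ n ≤ 1 := pow_le_one₀ (by linarith) (by linarith)
  rw [Real.norm_of_nonneg (by positivity), hts]
  -- Bernoulli gives `n s ≤ (1 + s)ⁿ`, and `(1 + s)(1 - s) ≤ 1`.
  have hb : n * s * (1 - s) ^ n ≤ 1 := by
    have h1 : 1 + n * s ≤ (1 + s) ^ n := one_add_mul_le_pow (by linarith) n
    have h2 : (1 + s) ^ n * (1 - s) ^ n ≤ 1 := by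
      rw [← mul_pow]; exact pow_le_one₀ (by nlinarith) (by nlinarith)
    nlinarith
  have hn' : (0 : ℝ) < n := by exact_mod_cast hn
  rw [le_div_iff₀ hn']
  calc (1 - s) ^ n * (c * s) * (1 - s) ^ n * n = c * (n * s * (1 - s) ^ n) * (1 - s) ^ n := by ring
    _ ≤ c * 1 * 1 := by gcongr
    _ = c := by ring

/-- The sequence `x₀ = a`, `xₙ₊₁ = xₙ (1 - c a* a)` tends to `0` for a suitable `c`. -/
theorem exists_tendsto_zero_gelfand {A : Type*} [NonUnitalCStarAlgebra A] (a : A) :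
    ∃ (c : ℝ) (x : ℕ → A), x 0 = a ∧ (∀ n, x (n + 1) = x n - c • (x n * (star a * a))) ∧
      Filter.Tendsto x Filter.atTop (𝓝 0) := by
  set c : ℝ := ‖star a * a‖⁻¹
  let x : ℕ → A := fun n => Nat.rec a (fun _ y => y - c • (y * (star a * a))) n
  refine ⟨c, x, rfl, fun n => rfl, ?_⟩
  -- The algebra need not have a unit; in the unitization the recursion has the closed form to which
  -- the norm estimate applies.
  have hx : ∀ n, Unitization.inr (R := ℂ) (x n) =
      (a : Unitization ℂ A) * (1 - c • (star (a : Unitization ℂ A) * a)) ^ n := by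
    intro n
    induction n with
    | zero => simp [x]
    | succ n ih =>
      have : x (n + 1) = x n - c • (x n * (star a * a)) := rfl
      rw [this, pow_succ, ← mul_assoc (a : Unitization ℂ A), ← ih, mul_sub, mul_one, mul_smul_comm]
      simp
  have hb : ∀ n : ℕ, 0 < n → ‖x n‖ ^ 2 ≤ ‖star a * a‖ / n := by
    intro n hn
    have := norm_sq_mul_one_sub_pow_le (a : Unitization ℂ A) n hn
    rw [← Unitization.inr_star, ← Unitization.inr_mul, Unitization.norm_inr, Unitization.inr_mul,
      Unitization.inr_star, ← hx n, Unitization.norm_inr] at this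
    exact this
  have h0 : Filter.Tendsto (fun n => ‖x n‖ ^ 2) Filter.atTop (𝓝 0) := by
    refine squeeze_zero' (Filter.Eventually.of_forall fun n => by positivity)
      (Filter.eventually_atTop.2 ⟨1, fun n hn => hb n hn⟩) (tendsto_const_div_atTop_nhds_zero_nat _)
  rw [tendsto_zero_iff_norm_tendsto_zero]
  simpa using h0.sqrt

end Gelfand

/-! ### The closed subspaces of a C*-algebra form a measurement space -/

namespace MaxSpace

variable {A : Type*} [NonUnitalCStarAlgebra A]

theorem isClosed_coe (P : MaxSpace A) : IsClosed (P : Set A) := ClosedSubmodule.isClosed P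

theorem zero_mem (P : MaxSpace A) : (0 : A) ∈ P := P.toSubmodule.zero_mem

theorem add_mem (P : MaxSpace A) {a b : A} (ha : a ∈ P) (hb : b ∈ P) : a + b ∈ P :=
  P.toSubmodule.add_mem ha hb

theorem sub_mem (P : MaxSpace A) {a b : A} (ha : a ∈ P) (hb : b ∈ P) : a - b ∈ P :=
  P.toSubmodule.sub_mem ha hb

theorem smul_mem (P : MaxSpace A) (c : ℂ) {a : A} (ha : a ∈ P) : c • a ∈ P :=
  P.toSubmodule.smul_mem c ha

theorem mem_bot {a : A} : a ∈ (⊥ : MaxSpace A) ↔ a = 0 := Iff.rfl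

theorem mem_closure {S : Submodule ℂ A} {a : A} :
    a ∈ (S.closure : MaxSpace A) ↔ a ∈ closure (S : Set A) := Iff.rfl

theorem mem_star {P : MaxSpace A} {a : A} : a ∈ star P ↔ star a ∈ P := Iff.rfl

theorem mem_sup {P Q : MaxSpace A} {x : A} :
    x ∈ P ⊔ Q ↔ x ∈ closure {c | ∃ a ∈ P, ∃ b ∈ Q, a + b = c} := by
  have : ({c | ∃ a ∈ P, ∃ b ∈ Q, a + b = c} : Set A) =
      (P.toSubmodule ⊔ Q.toSubmodule : Submodule ℂ A) := by
    ext c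
    exact Submodule.mem_sup.symm
  rw [this]
  exact Iff.rfl

theorem mul_le {P Q R : MaxSpace A} : P * Q ≤ R ↔ ∀ a ∈ P, ∀ b ∈ Q, a * b ∈ R := by
  refine (Submodule.closure_le (t := R)).trans (Submodule.span_le.trans ?_)
  constructor
  · intro h a ha b hb
    exact h ⟨a, ha, b, hb, rfl⟩
  · rintro h _ ⟨a, ha, b, hb, rfl⟩
    exact h a ha b hb

theorem mul_mem_mul {P Q : MaxSpace A} {a b : A} (ha : a ∈ P) (hb : b ∈ Q) : a * b ∈ P * Q :=
  mul_le.1 le_rfl a ha b hb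

theorem mul_le_mul {P P' Q Q' : MaxSpace A} (h : P ≤ P') (h' : Q ≤ Q') : P * Q ≤ P' * Q' :=
  mul_le.2 fun _ ha _ hb => mul_mem_mul (h ha) (h' hb)

theorem star_star_eq (P : MaxSpace A) : star (star P) = P :=
  SetLike.ext fun a => by rw [mem_star, mem_star, star_star]

theorem star_le {P Q : MaxSpace A} : star P ≤ Q ↔ P ≤ star Q := by
  constructor
  · intro h a ha
    exact h (mem_star.2 (by rwa [star_star]))
  · intro h a ha
    have := mem_star.1 (h (mem_star.1 ha))
    rwa [star_star] at this

theorem isOpen_meets {U : Set A} (hU : IsOpen U) :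
    IsOpen {P : MaxSpace A | ((P : Set A) ∩ U).Nonempty} :=
  TopologicalSpace.isOpen_generateFrom_of_mem ⟨U, hU, rfl⟩

theorem eventually_meets {P : MaxSpace A} {a : A} (ha : a ∈ P) {U : Set A} (hU : IsOpen U)
    (haU : a ∈ U) : ∀ᶠ Q in 𝓝 P, ∃ b ∈ Q, b ∈ U :=
  (isOpen_meets hU).mem_nhds ⟨a, ha, haU⟩

/-- The sets of subspaces that meet a given open set form a subbasis of the lower Vietoris topology.
-/
theorem continuous_of_eventually {Z : Type*} [TopologicalSpace Z] {F : Z → MaxSpace A}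
    (h : ∀ z, ∀ a ∈ F z, ∀ U : Set A, IsOpen U → a ∈ U → ∀ᶠ z' in 𝓝 z, ∃ b ∈ F z', b ∈ U) :
    Continuous F := by
  refine continuous_generateFrom_iff.2 ?_
  rintro _ ⟨U, hU, rfl⟩
  rw [isOpen_iff_mem_nhds]
  rintro z ⟨a, ha, haU⟩
  exact h z a ha U hU haU

theorem exists_isOpen_add {U : Set A} (hU : IsOpen U) {a b : A} (h : a + b ∈ U) :
    ∃ V W : Set A, IsOpen V ∧ IsOpen W ∧ a ∈ V ∧ b ∈ W ∧ ∀ x ∈ V, ∀ y ∈ W, x + y ∈ U := by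
  obtain ⟨V, W, hV, hW, ha, hb, hVW⟩ := isOpen_prod_iff.1 (hU.preimage continuous_add) a b h
  exact ⟨V, W, hV, hW, ha, hb, fun x hx y hy => hVW (Set.mk_mem_prod hx hy)⟩

theorem exists_isOpen_mul {U : Set A} (hU : IsOpen U) {a b : A} (h : a * b ∈ U) :
    ∃ V W : Set A, IsOpen V ∧ IsOpen W ∧ a ∈ V ∧ b ∈ W ∧ ∀ x ∈ V, ∀ y ∈ W, x * y ∈ U := by
  obtain ⟨V, W, hV, hW, ha, hb, hVW⟩ := isOpen_prod_iff.1 (hU.preimage continuous_mul) a b h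
  exact ⟨V, W, hV, hW, ha, hb, fun x hx y hy => hVW (Set.mk_mem_prod hx hy)⟩

theorem continuous_sup : Continuous fun p : MaxSpace A × MaxSpace A => p.1 ⊔ p.2 := by
  refine continuous_of_eventually ?_
  rintro ⟨P, Q⟩ x hx U hU hxU
  obtain ⟨_, hyU, a, ha, b, hb, rfl⟩ := mem_closure_iff.1 (mem_sup.1 hx) U hU hxU
  obtain ⟨V, W, hV, hW, haV, hbW, hVW⟩ :=
    exists_isOpen_add hU hyU
  filter_upwards [(eventually_meets ha hV haV).prod_nhds (eventually_meets hb hW hbW)]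
  rintro ⟨P', Q'⟩ ⟨⟨a', ha', haV'⟩, b', hb', hbW'⟩
  exact ⟨a' + b', mem_sup.2 (subset_closure ⟨a', ha', b', hb', rfl⟩), hVW _ haV' _ hbW'⟩

theorem continuous_star : Continuous (star : MaxSpace A → MaxSpace A) := by
  refine continuous_of_eventually fun P a ha U hU haU => ?_
  have h := eventually_meets (mem_star.1 ha) (hU.preimage (ContinuousStar.continuous_star (R := A)))
    (by rwa [Set.mem_preimage, star_star])
  filter_upwards [h] with Q ⟨b, hb, hbU⟩
  exact ⟨star b, mem_star.2 (by rwa [star_star]), hbU⟩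

theorem continuous_mul : Continuous fun p : MaxSpace A × MaxSpace A => p.1 * p.2 := by
  refine continuous_of_eventually ?_
  rintro ⟨P, Q⟩ x hx U hU hxU
  -- An open set that meets the closure meets the algebraic span, so only finite combinations of
  -- products have to be followed under perturbation.
  obtain ⟨y, hyU, hy⟩ := mem_closure_iff.1 (mem_closure.1 hx) U hU hxU
  clear hx hxU
  change ∀ᶠ z in 𝓝 (P, Q), ∃ b ∈ z.1 * z.2, b ∈ U
  induction hy using Submodule.span_induction generalizing U with
  | mem y hy =>
    obtain ⟨a, ha, b, hb, rfl⟩ := hy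
    obtain ⟨V, W, hV, hW, haV, hbW, hVW⟩ :=
      exists_isOpen_mul hU hyU
    filter_upwards [(eventually_meets ha hV haV).prod_nhds (eventually_meets hb hW hbW)]
    rintro ⟨P', Q'⟩ ⟨⟨a', ha', haV'⟩, b', hb', hbW'⟩
    exact ⟨a' * b', mul_mem_mul ha' hb', hVW _ haV' _ hbW'⟩
  | zero => exact Filter.Eventually.of_forall fun z => ⟨0, zero_mem _, hyU⟩
  | add y z _ _ ihy ihz =>
    obtain ⟨V, W, hV, hW, haV, hbW, hVW⟩ :=
      exists_isOpen_add hU hyU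
    filter_upwards [ihy V hV haV, ihz W hW hbW]
    rintro w ⟨a, ha, haV⟩ ⟨b, hb, hbW⟩
    exact ⟨a + b, add_mem _ ha hb, hVW _ haV _ hbW⟩
  | smul c y _ ih =>
    filter_upwards [ih _ (hU.preimage (continuous_const_smul c)) hyU]
    rintro w ⟨a, ha, haU⟩
    exact ⟨c • a, smul_mem _ c ha, haU⟩

theorem le_of_forall_isOpen {P Q : MaxSpace A}
    (h : ∀ U : Set (MaxSpace A), IsOpen U → P ∈ U → Q ∈ U) : P ≤ Q := by
  intro a ha
  by_contra hc
  obtain ⟨b, hb, hb'⟩ := h _ (isOpen_meets Q.isClosed_coe.isOpen_compl) ⟨a, ha, hc⟩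
  exact hb' hb

/-- A larger subspace meets every open set that a smaller one meets; this passes from the subbasis
to all open sets. -/
theorem mem_of_isOpen_of_le {P Q : MaxSpace A} (hPQ : P ≤ Q) {U : Set (MaxSpace A)}
    (hU : IsOpen U) (hP : P ∈ U) : Q ∈ U := by
  induction hU with
  | basic s hs =>
    obtain ⟨V, -, rfl⟩ := hs
    obtain ⟨a, ha, haV⟩ := hP
    exact ⟨a, hPQ ha, haV⟩
  | univ => trivial
  | inter s t _ _ hs ht => exact ⟨hs hP.1, ht hP.2⟩
  | sUnion S _ h =>
    obtain ⟨s, hs, hPs⟩ := hP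
    exact ⟨s, hs, h s hs hPs⟩

/-- An irreducible closed set of closed subspaces has a greatest element. -/
theorem exists_generic {C : Set (MaxSpace A)} (hC : IsIrreducible C) (hCc : IsClosed C) :
    ∃ P : MaxSpace A, P ∈ C ∧ ∀ Q ∈ C, Q ≤ P := by
  -- `P` consists of the points all of whose neighbourhoods are met by members of `C`.
  -- Irreducibility supplies one member meeting two neighbourhoods at once, hence closure under
  -- addition.
  let P : MaxSpace A := ⟨
    { carrier := {a | ∀ U : Set A, IsOpen U → a ∈ U → (C ∩ {Q | ((Q : Set A) ∩ U).Nonempty}).Nonempty}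
      add_mem' := by
        intro a b ha hb U hU habU
        obtain ⟨V, W, hV, hW, haV, hbW, hVW⟩ :=
          exists_isOpen_add hU habU
        obtain ⟨Q, hQ, ⟨a', ha', haV'⟩, b', hb', hbW'⟩ := hC.2 _ _ (isOpen_meets hV)
          (isOpen_meets hW) (ha V hV haV) (hb W hW hbW)
        exact ⟨Q, hQ, a' + b', add_mem _ ha' hb', hVW _ haV' _ hbW'⟩
      zero_mem' := by
        intro U hU h0
        obtain ⟨Q, hQ⟩ := hC.1
        exact ⟨Q, hQ, 0, zero_mem Q, h0⟩
      smul_mem' := by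
        intro c a ha U hU hcU
        obtain ⟨Q, hQ, b, hb, hbU⟩ := ha _ (hU.preimage (continuous_const_smul c)) hcU
        exact ⟨Q, hQ, c • b, smul_mem Q c hb, hbU⟩ }, by
    refine isClosed_of_closure_subset fun a ha U hU haU => ?_
    obtain ⟨b, hbU, hb⟩ := mem_closure_iff.1 ha U hU haU
    exact hb U hU hbU⟩
  refine ⟨P, ?_, fun Q hQ a ha U hU haU => ⟨Q, hQ, a, ha, haU⟩⟩
  -- Every open neighbourhood of `P` meets `C`; since `C` is closed, `P` belongs to it.
  -- Irreducibility is used again for finite intersections.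
  have key : ∀ U : Set (MaxSpace A), IsOpen U → P ∈ U → ∃ V, V ⊆ U ∧ IsOpen V ∧ (C ∩ V).Nonempty := by
    intro U hU hP
    induction hU with
    | basic s hs =>
      obtain ⟨V, hV, rfl⟩ := hs
      obtain ⟨a, ha, haV⟩ := hP
      exact ⟨_, subset_rfl, isOpen_meets hV, ha V hV haV⟩
    | univ => exact ⟨Set.univ, subset_rfl, isOpen_univ, by simpa using hC.1⟩
    | inter s t _ _ hs ht =>
      obtain ⟨V, hVs, hV, hCV⟩ := hs hP.1
      obtain ⟨W, hWt, hW, hCW⟩ := ht hP.2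
      exact ⟨V ∩ W, Set.inter_subset_inter hVs hWt, hV.inter hW, hC.2 _ _ hV hW hCV hCW⟩
    | sUnion S _ h =>
      obtain ⟨s, hs, hPs⟩ := hP
      obtain ⟨V, hVs, hV⟩ := h s hs hPs
      exact ⟨V, hVs.trans (Set.subset_sUnion_of_mem hs), hV⟩
  by_contra hPC
  obtain ⟨V, hVC, -, Q, hQ, hQV⟩ := key _ hCc.isOpen_compl hPC
  exact hVC hQV hQ

theorem isSoberLattice : IsSoberLattice (MaxSpace A) where
  t0 := ⟨fun P Q h => le_antisymm
    (le_of_forall_isOpen fun _ hU => (h.mem_open_iff hU).1)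
    (le_of_forall_isOpen fun _ hU => (h.mem_open_iff hU).2)⟩
  quasiSober := ⟨by
    intro C hC hCc
    obtain ⟨P, hP, hle⟩ := exists_generic hC hCc
    refine ⟨P, subset_antisymm (hCc.closure_subset_iff.2 (Set.singleton_subset_iff.2 hP)) ?_⟩
    intro Q hQ
    exact mem_closure_iff.2 fun U hU hQU => ⟨P, mem_of_isOpen_of_le (hle Q hQ) hU hQU, rfl⟩⟩
  le_iff _ _ := ⟨fun h _ hU => mem_of_isOpen_of_le h hU, le_of_forall_isOpen⟩
  continuous_sup := continuous_sup

theorem mul_assoc_eq (P Q R : MaxSpace A) : P * Q * R = P * (Q * R) := by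
  refine le_antisymm (mul_le.2 fun x hx c hc => ?_) (mul_le.2 fun a ha x hx => ?_)
  · let Z : MaxSpace A := ClosedSubmodule.comap ((ContinuousLinearMap.mul ℂ A).flip c) (P * (Q * R))
    have : P * Q ≤ Z := mul_le.2 fun a ha b hb => by
      change a * b * c ∈ P * (Q * R)
      rw [mul_assoc]
      exact mul_mem_mul ha (mul_mem_mul hb hc)
    exact this hx
  · let Z : MaxSpace A := ClosedSubmodule.comap (ContinuousLinearMap.mul ℂ A a) (P * Q * R)
    have : Q * R ≤ Z := mul_le.2 fun b hb c hc => by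
      change a * (b * c) ∈ P * Q * R
      rw [← mul_assoc]
      exact mul_mem_mul (mul_mem_mul ha hb) hc
    exact this hx

theorem mul_sup_eq (P Q R : MaxSpace A) : P * (Q ⊔ R) = P * Q ⊔ P * R := by
  refine le_antisymm (mul_le.2 fun a ha x hx => ?_) (sup_le (mul_le_mul le_rfl le_sup_left)
    (mul_le_mul le_rfl le_sup_right))
  let Z : MaxSpace A := ClosedSubmodule.comap (ContinuousLinearMap.mul ℂ A a) (P * Q ⊔ P * R)
  have : Q ⊔ R ≤ Z := sup_le (fun b hb => (le_sup_left : P * Q ≤ _) (mul_mem_mul ha hb))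
    (fun b hb => (le_sup_right : P * R ≤ P * Q ⊔ P * R) (mul_mem_mul ha hb))
  exact this hx

theorem le_star_mul_star (P Q : MaxSpace A) : star (P * Q) ≤ star Q * star P :=
  star_le.2 (mul_le.2 fun a ha b hb => mem_star.2 (by
    rw [star_mul]
    exact mul_mem_mul (mem_star.2 (by rwa [star_star])) (mem_star.2 (by rwa [star_star]))))

theorem star_mul_eq (P Q : MaxSpace A) : star (P * Q) = star Q * star P := by
  refine le_antisymm (le_star_mul_star P Q) ?_
  have h := star_le.1 (le_star_mul_star (star Q) (star P))
  rwa [star_star_eq, star_star_eq] at h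

/-- For `a ∈ P` one removes the multiples `c xₙ a* a` successively. All of them lie in `P P* P` as
long as `xₙ ∈ P`, and the remainders `xₙ` tend to `0`. -/
theorem stablyGelfand (P : MaxSpace A) (h : P * star P * P ≤ P) : P ≤ P * star P * P := by
  intro a ha
  obtain ⟨c, x, hx0, hx, hlim⟩ := exists_tendsto_zero_gelfand a
  have hmem : ∀ n, a - x n ∈ P * star P * P := by
    intro n
    induction n with
    | zero => rw [hx0, sub_self]; exact zero_mem _
    | succ n ih =>
      -- Here the assumption `P P* P ≤ P` enters: `a - x n` lies in `P`, hence so does `x n`.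
      have hxn : x n ∈ P := by
        have := P.sub_mem ha (h ih)
        rwa [sub_sub_cancel] at this
      have hsa : star a ∈ star P := mem_star.2 (by rwa [star_star])
      have e : a - x (n + 1) = (a - x n) + (c : ℂ) • (x n * star a * a) := by
        rw [hx, mul_assoc, Complex.coe_smul]; abel
      rw [e]
      exact add_mem _ ih (smul_mem _ _ (mul_mem_mul (mul_mem_mul hxn hsa) ha))
  have ht : Filter.Tendsto (fun n => a - x n) Filter.atTop (𝓝 a) := by
    simpa using hlim.const_sub a
  exact (isClosed_coe _).mem_of_tendsto ht (Filter.Eventually.of_forall hmem)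

theorem isMeasurementSpace : IsMeasurementSpace (MaxSpace A) where
  toIsSoberLattice := isSoberLattice
  continuous_mul := continuous_mul
  continuous_star := continuous_star
  mul_assoc := mul_assoc_eq
  mul_bot P := le_bot_iff.1 (mul_le.2 fun a _ b hb => by
    rw [mem_bot] at hb ⊢
    rw [hb, mul_zero])
  mul_sup := mul_sup_eq
  star_star := star_star_eq
  star_mul := star_mul_eq
  stablyGelfand := stablyGelfand

end MaxSpace

/-! ### Cancellation rules in a groupoid -/

namespace TopGroupoid

variable {X G : Type*} [TopologicalSpace X] [TopologicalSpace G] (𝒢 : TopGroupoid X G)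

theorem inv_injective : Function.Injective 𝒢.inv := Function.LeftInverse.injective 𝒢.inv_inv

/-- `(g h)⁻¹ = h⁻¹ g⁻¹`. -/
theorem inv_mul_rev {g h : G} (hgh : 𝒢.d g = 𝒢.r h) :
    𝒢.inv (𝒢.mul g h) = 𝒢.mul (𝒢.inv h) (𝒢.inv g) := by
  have := 𝒢.inv_mul_inv (g := g) (k := 𝒢.inv h) (by rw [𝒢.d_inv, hgh])
  rwa [𝒢.inv_inv] at this

/-- `g⁻¹ (g h) = h`. -/
theorem inv_mul_cancel_left {g h : G} (hgh : 𝒢.d g = 𝒢.r h) :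
    𝒢.mul (𝒢.inv g) (𝒢.mul g h) = h := by
  rw [← 𝒢.mul_assoc _ _ _ (𝒢.d_inv g) hgh, 𝒢.inv_mul, hgh, 𝒢.u_mul]

/-- If `g h⁻¹` is a unit, then `g = h`. -/
theorem eq_of_mul_inv_mem {g h : G} (hgh : 𝒢.d g = 𝒢.d h) {x : X}
    (hx : 𝒢.mul g (𝒢.inv h) = 𝒢.u x) : g = h := by
  have e := 𝒢.mul_inv_mul_cancel hgh
  have hr : x = 𝒢.r h := by
    have := congrArg 𝒢.d hx
    rw [𝒢.d_mul _ _ (by rw [𝒢.r_inv, hgh]), 𝒢.d_inv, 𝒢.d_u] at this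
    exact this.symm
  rw [hx, hr, 𝒢.u_mul] at e
  exact e.symm

end TopGroupoid

/-! ### The open sets of arrows form a classical measurement space and an inverse quantal frame -/

namespace EtaleGroupoid

namespace MS

variable {X G : Type*} [TopologicalSpace X] [TopologicalSpace G] {𝒢 : EtaleGroupoid X G}

instance : Topology.IsScott 𝒢.MS Set.univ := ⟨rfl⟩

theorem isOpen_coe (U : 𝒢.MS) : IsOpen (U : Set G) := TopologicalSpace.Opens.isOpen U

theorem mem_sup {U V : 𝒢.MS} {g : G} : g ∈ U ⊔ V ↔ g ∈ U ∨ g ∈ V := Iff.rfl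

theorem mem_inf {U V : 𝒢.MS} {g : G} : g ∈ U ⊓ V ↔ g ∈ U ∧ g ∈ V := Iff.rfl

theorem mem_sSup {S : Set 𝒢.MS} {g : G} : g ∈ sSup S ↔ ∃ U ∈ S, g ∈ U :=
  TopologicalSpace.Opens.mem_sSup

theorem mem_iSup {ι : Sort*} {F : ι → 𝒢.MS} {g : G} : g ∈ ⨆ i, F i ↔ ∃ i, g ∈ F i :=
  TopologicalSpace.Opens.mem_iSup

theorem mem_bot {g : G} : g ∈ (⊥ : 𝒢.MS) ↔ False := Iff.rfl

theorem mem_top {g : G} : g ∈ (⊤ : 𝒢.MS) := trivial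

theorem mem_mul {U V : 𝒢.MS} {x : G} :
    x ∈ U * V ↔ ∃ g ∈ U, ∃ h ∈ V, 𝒢.d g = 𝒢.r h ∧ 𝒢.mul g h = x := Iff.rfl

theorem mul_mem_mul {U V : 𝒢.MS} {g h : G} (hg : g ∈ U) (hh : h ∈ V) (hgh : 𝒢.d g = 𝒢.r h) :
    𝒢.mul g h ∈ U * V := ⟨g, hg, h, hh, hgh, rfl⟩

theorem mem_star {U : 𝒢.MS} {g : G} : g ∈ star U ↔ 𝒢.inv g ∈ U := Iff.rfl

theorem inv_mem_star {U : 𝒢.MS} {g : G} (hg : g ∈ U) : 𝒢.inv g ∈ star U := by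
  rwa [mem_star, 𝒢.inv_inv]

theorem u_mem_one (x : X) : 𝒢.u x ∈ (1 : 𝒢.MS) := ⟨x, rfl⟩

theorem mul_le_mul {U U' V V' : 𝒢.MS} (hU : U ≤ U') (hV : V ≤ V') : U * V ≤ U' * V' := by
  rintro _ ⟨g, hg, h, hh, hgh, rfl⟩
  exact mul_mem_mul (hU hg) (hV hh) hgh

theorem star_star_eq (U : 𝒢.MS) : star (star U) = U :=
  SetLike.ext fun g => by rw [mem_star, mem_star, 𝒢.inv_inv]

theorem mul_assoc_eq (U V W : 𝒢.MS) : U * V * W = U * (V * W) := by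
  refine SetLike.ext fun x => ⟨?_, ?_⟩
  · rintro ⟨_, ⟨g, hg, h, hh, hgh, rfl⟩, k, hk, hc, rfl⟩
    rw [𝒢.d_mul _ _ hgh] at hc
    refine ⟨g, hg, _, mul_mem_mul hh hk hc, ?_, (𝒢.mul_assoc g h k hgh hc).symm⟩
    rw [𝒢.r_mul _ _ hc, hgh]
  · rintro ⟨g, hg, _, ⟨h, hh, k, hk, hhk, rfl⟩, hc, rfl⟩
    rw [𝒢.r_mul _ _ hhk] at hc
    refine ⟨_, mul_mem_mul hg hh hc, k, hk, ?_, 𝒢.mul_assoc g h k hc hhk⟩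
    rw [𝒢.d_mul _ _ hc, hhk]

theorem star_mul_eq (U V : 𝒢.MS) : star (U * V) = star V * star U := by
  refine SetLike.ext fun x => ⟨?_, ?_⟩
  · rintro ⟨g, hg, h, hh, hgh, e⟩
    refine ⟨𝒢.inv h, inv_mem_star hh, 𝒢.inv g, inv_mem_star hg, ?_, ?_⟩
    · rw [𝒢.d_inv, 𝒢.r_inv, hgh]
    · rw [← 𝒢.inv_mul_rev hgh, e, 𝒢.inv_inv]
  · rintro ⟨g, hg, h, hh, hgh, rfl⟩
    refine ⟨𝒢.inv h, hh, 𝒢.inv g, hg, ?_, (𝒢.inv_mul_rev hgh).symm⟩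
    rw [𝒢.d_inv, 𝒢.r_inv, hgh]

theorem mul_sSup_eq (U : 𝒢.MS) (S : Set 𝒢.MS) : U * sSup S = ⨆ V ∈ S, U * V := by
  refine SetLike.ext fun x => ?_
  simp only [mem_mul, mem_sSup, mem_iSup]
  constructor
  · rintro ⟨g, hg, h, ⟨V, hV, hh⟩, e⟩
    exact ⟨V, hV, g, hg, h, hh, e⟩
  · rintro ⟨V, hV, g, hg, h, hh, e⟩
    exact ⟨g, hg, h, ⟨V, hV, hh⟩, e⟩

theorem sSup_mul_eq (S : Set 𝒢.MS) (U : 𝒢.MS) : sSup S * U = ⨆ V ∈ S, V * U := by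
  refine SetLike.ext fun x => ?_
  simp only [mem_mul, mem_sSup, mem_iSup]
  constructor
  · rintro ⟨g, ⟨V, hV, hg⟩, h⟩
    exact ⟨V, hV, g, hg, h⟩
  · rintro ⟨V, hV, g, hg, h⟩
    exact ⟨g, ⟨V, hV, hg⟩, h⟩

theorem star_sSup_eq (S : Set 𝒢.MS) : star (sSup S) = ⨆ V ∈ S, star V := by
  refine SetLike.ext fun x => ?_
  simp only [mem_star, mem_sSup, mem_iSup, exists_prop]

theorem inf_sSup_eq (U : 𝒢.MS) (S : Set 𝒢.MS) : U ⊓ sSup S = ⨆ V ∈ S, U ⊓ V := by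
  refine SetLike.ext fun x => ?_
  simp only [mem_inf, mem_sSup, mem_iSup]
  constructor
  · rintro ⟨h, V, hV, hx⟩
    exact ⟨V, hV, h, hx⟩
  · rintro ⟨V, hV, h, hx⟩
    exact ⟨h, V, hV, hx⟩

theorem mul_sup_eq (U V W : 𝒢.MS) : U * (V ⊔ W) = U * V ⊔ U * W := by
  rw [← sSup_pair, mul_sSup_eq, iSup_pair]

theorem mul_bot_eq (U : 𝒢.MS) : U * ⊥ = ⊥ := by
  rw [← sSup_empty, mul_sSup_eq]
  simp

theorem one_mul_eq (U : 𝒢.MS) : 1 * U = U := by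
  refine SetLike.ext fun x => ⟨?_, fun hx => ?_⟩
  · rintro ⟨_, ⟨y, rfl⟩, h, hh, hc, rfl⟩
    rw [𝒢.d_u] at hc
    rwa [hc, 𝒢.u_mul]
  · exact ⟨_, u_mem_one (𝒢.r x), x, hx, 𝒢.d_u _, 𝒢.u_mul x⟩

theorem mul_one_eq (U : 𝒢.MS) : U * 1 = U := by
  refine SetLike.ext fun x => ⟨?_, fun hx => ?_⟩
  · rintro ⟨h, hh, _, ⟨y, rfl⟩, hc, rfl⟩
    rw [𝒢.r_u] at hc
    rwa [← hc, 𝒢.mul_u]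
  · exact ⟨x, hx, _, u_mem_one (𝒢.d x), (𝒢.r_u _).symm, 𝒢.mul_u x⟩

theorem star_one_eq : star (1 : 𝒢.MS) = 1 := by
  refine SetLike.ext fun x => ⟨?_, ?_⟩
  · rintro ⟨y, hy⟩
    exact ⟨y, by rw [← 𝒢.inv_inv x, ← hy, 𝒢.inv_u]⟩
  · rintro ⟨y, rfl⟩
    exact ⟨y, (𝒢.inv_u y).symm⟩

/-- Every arrow satisfies `g = g g⁻¹ g`. -/
theorem le_mul_star_mul (U : 𝒢.MS) : U ≤ U * star U * U := by
  intro g hg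
  have h := mul_mem_mul (mul_mem_mul hg (inv_mem_star hg) (𝒢.r_inv g).symm) hg
    (by rw [𝒢.d_mul _ _ (𝒢.r_inv g).symm, 𝒢.d_inv])
  rwa [𝒢.mul_inv, 𝒢.u_mul] at h

theorem mul_star_le_one {U : 𝒢.MS} (h : Set.InjOn 𝒢.d (U : Set G)) : U * star U ≤ 1 := by
  rintro _ ⟨g, hg, k, hk, hgk, rfl⟩
  have : g = 𝒢.inv k := h hg hk (by rw [𝒢.d_inv, hgk])
  refine ⟨𝒢.r g, ?_⟩
  rw [← 𝒢.inv_inv k, ← this, 𝒢.mul_inv]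

theorem star_mul_le_one {U : 𝒢.MS} (h : Set.InjOn 𝒢.r (U : Set G)) : star U * U ≤ 1 := by
  rintro _ ⟨k, hk, g, hg, hgk, rfl⟩
  have : g = 𝒢.inv k := h hg hk (by rw [𝒢.r_inv, hgk])
  refine ⟨𝒢.d g, ?_⟩
  rw [← 𝒢.inv_inv k, ← this, 𝒢.inv_mul]

theorem injOn_d_of_mul_star_le_one {U : 𝒢.MS} (h : U * star U ≤ 1) :
    Set.InjOn 𝒢.d (U : Set G) := by
  intro g hg k hk hgk
  obtain ⟨x, hx⟩ := h (mul_mem_mul hg (inv_mem_star hk) (by rw [𝒢.r_inv, hgk]))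
  exact 𝒢.eq_of_mul_inv_mem hgk hx.symm

/-- Every arrow of an open set lies in a smaller open bisection. -/
theorem exists_bisection (U : 𝒢.MS) {g : G} (hg : g ∈ U) :
    ∃ V : 𝒢.MS, g ∈ V ∧ V ≤ U ∧ Set.InjOn 𝒢.d (V : Set G) ∧ Set.InjOn 𝒢.r (V : Set G) := by
  obtain ⟨V, hV, hgV, hd⟩ := 𝒢.exists_injOn_d g
  obtain ⟨W, hW, hgW, hr⟩ := 𝒢.exists_injOn_d (𝒢.inv g)
  refine ⟨⟨U ∩ (V ∩ 𝒢.inv ⁻¹' W), U.isOpen_coe.inter (hV.inter (hW.preimage 𝒢.continuous_inv))⟩,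
    ⟨hg, hgV, hgW⟩, fun x hx => hx.1, hd.mono fun x hx => hx.2.1, ?_⟩
  intro x hx y hy hxy
  exact 𝒢.inv_injective (hr hx.2.2 hy.2.2 (by rw [𝒢.d_inv, 𝒢.d_inv, hxy]))

/-- Open bisections are partial units, and they cover the arrows because `d` and `r` are locally
injective. -/
theorem top_eq_sSup_partialUnits : (⊤ : 𝒢.MS) = sSup (partialUnits 𝒢.MS) := by
  refine SetLike.ext fun g => ⟨fun _ => ?_, fun _ => mem_top⟩
  obtain ⟨V, hgV, -, hd, hr⟩ := exists_bisection (⊤ : 𝒢.MS) (mem_top (g := g))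
  exact mem_sSup.2 ⟨V, ⟨mul_star_le_one hd, star_mul_le_one hr⟩, hgV⟩

theorem isInverseQuantalFrame : IsInverseQuantalFrame 𝒢.MS where
  mul_assoc := mul_assoc_eq
  mul_sSup := mul_sSup_eq
  sSup_mul := sSup_mul_eq
  one_mul := one_mul_eq
  mul_one := mul_one_eq
  star_star := star_star_eq
  star_mul := star_mul_eq
  star_sSup := star_sSup_eq
  stablyGelfand U _ := le_mul_star_mul U
  inf_sSup := inf_sSup_eq
  top_eq := top_eq_sSup_partialUnits

theorem isWayBelow_of_isCompact {U V : 𝒢.MS} {K : Set G} (hK : IsCompact K)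
    (hVK : (V : Set G) ⊆ K) (hKU : K ⊆ U) : IsWayBelow V U := by
  intro D hD hdir hU
  have : Nonempty D := hD.to_subtype
  obtain ⟨W, hW⟩ := hK.elim_directed_cover (fun W : D => (W.1 : Set G)) (fun W => W.1.isOpen_coe)
    (fun g hg => by
      obtain ⟨W, hW, hgW⟩ := mem_sSup.1 (hU (hKU hg))
      exact Set.mem_iUnion.2 ⟨⟨W, hW⟩, hgW⟩)
    (fun A B => by
      obtain ⟨C, hC, hAC, hBC⟩ := hdir A.1 A.2 B.1 B.2
      exact ⟨⟨C, hC⟩, hAC, hBC⟩)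
  exact ⟨W.1, W.2, fun g hg => hW (hVK hg)⟩

theorem le_of_isWayBelow {U V : 𝒢.MS} (h : IsWayBelow V U) : V ≤ U := by
  obtain ⟨z, hz, hVz⟩ := h {U} ⟨U, rfl⟩ (directedOn_singleton U) (by simp)
  rwa [Set.mem_singleton_iff.1 hz] at hVz

/-- A directed open cover of a compact set has a member that already contains it; this is Scott
openness. -/
theorem isOpen_setOf_superset {K : Set G} (hK : IsCompact K) :
    IsOpen {U : 𝒢.MS | K ⊆ U} := by
  refine (Topology.IsScott.isOpen_iff_isUpperSet_and_dirSupInaccOn (D := Set.univ)).2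
    ⟨fun U V hUV hU g hg => hUV (hU hg), fun D _ hD hdir U hU hKU => ?_⟩
  have : Nonempty D := hD.to_subtype
  obtain ⟨W, hW⟩ := hK.elim_directed_cover (fun W : D => (W.1 : Set G)) (fun W => W.1.isOpen_coe)
    (fun g hg => by
      have := hKU hg
      rw [← hU.sSup_eq] at this
      obtain ⟨W, hW, hgW⟩ := mem_sSup.1 this
      exact Set.mem_iUnion.2 ⟨⟨W, hW⟩, hgW⟩)
    (fun A B => by
      obtain ⟨C, hC, hAC, hBC⟩ := hdir A.1 A.2 B.1 B.2
      exact ⟨⟨C, hC⟩, hAC, hBC⟩)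
  exact ⟨W.1, W.2, hW⟩

theorem eventually_superset {K : Set G} (hK : IsCompact K) {U : 𝒢.MS} (hKU : K ⊆ U) :
    ∀ᶠ V : 𝒢.MS in 𝓝 U, K ⊆ V :=
  (isOpen_setOf_superset hK).mem_nhds hKU

section LocallyCompact

variable [LocallyCompactSpace G]

theorem eventually_mem {U : 𝒢.MS} {g : G} (hg : g ∈ U) :
    ∀ᶠ p : 𝒢.MS × G in 𝓝 U ×ˢ 𝓝 g, p.2 ∈ p.1 := by
  obtain ⟨K, hK, hgK, hKU⟩ := exists_compact_subset U.isOpen_coe hg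
  filter_upwards [(eventually_superset hK hKU).prod_mk
    (isOpen_interior.eventually_mem hgK)] with p hp
  exact hp.1 (interior_subset hp.2)

/-- An open set in the topology of the lattice of open sets that contains `U` contains an open set
which is relatively compact in `U`. -/
theorem exists_isCompact_mem {U : 𝒢.MS} {s : Set 𝒢.MS} (hs : IsOpen s) (hU : U ∈ s) :
    ∃ V ∈ s, ∃ K : Set G, IsCompact K ∧ (V : Set G) ⊆ K ∧ K ⊆ U := by
  have h : DirSupInaccOn Set.univ s :=
    (Topology.IsScott.isOpen_iff_isUpperSet_and_dirSupInaccOn (D := Set.univ)).1 hs |>.2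
  set D : Set 𝒢.MS := {V | ∃ K : Set G, IsCompact K ∧ (V : Set G) ⊆ K ∧ K ⊆ U}
  have hne : D.Nonempty := ⟨⊥, ∅, isCompact_empty, fun g hg => hg, Set.empty_subset _⟩
  have hdir : DirectedOn (· ≤ ·) D := by
    rintro A ⟨K, hK, hA, hKU⟩ B ⟨L, hL, hB, hLU⟩
    exact ⟨A ⊔ B, ⟨K ∪ L, hK.union hL, Set.union_subset_union hA hB, Set.union_subset hKU hLU⟩,
      le_sup_left, le_sup_right⟩
  -- By local compactness `U` is the union of the interiors of its compact subsets, and a Scott open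
  -- set is inaccessible by directed suprema.
  have hlub : IsLUB D U := by
    refine ⟨?_, fun W hW g hg => ?_⟩
    · rintro A ⟨K, hK, hA, hKU⟩ g hg
      exact hKU (hA hg)
    · obtain ⟨K, hK, hgK, hKU⟩ := exists_compact_subset U.isOpen_coe hg
      have : (⟨interior K, isOpen_interior⟩ : 𝒢.MS) ∈ D := ⟨K, hK, interior_subset, hKU⟩
      exact hW this hgK
  obtain ⟨V, hV, hVs⟩ := h (Set.mem_univ D) hne hdir hlub hU
  exact ⟨V, hVs, hV⟩

/-- A Scott neighbourhood of `F z` contains some `V` inside a compact `K ⊆ F z`. By the tube lemma,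
`K ⊆ F z'` for all `z'` near `z`, and Scott open sets are upper sets. -/
theorem continuous_of_eventually {Z : Type*} [TopologicalSpace Z] {F : Z → 𝒢.MS}
    (h : ∀ z, ∀ g ∈ F z, ∀ᶠ p : Z × G in 𝓝 (z, g), p.2 ∈ F p.1) : Continuous F := by
  refine continuous_def.2 fun s hs => isOpen_iff_mem_nhds.2 fun z hz => ?_
  obtain ⟨V, hV, K, hK, hVK, hKF⟩ := exists_isCompact_mem hs hz
  filter_upwards [hK.eventually_forall_of_forall_eventually (x₀ := z)
    (P := fun z' g => g ∈ F z') fun g hg => h z g (hKF hg)] with z' hz'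
  exact Topology.IsScott.isUpperSet_of_isOpen (D := Set.univ) hs
    (fun g hg => hz' g (hVK hg)) hV

theorem continuous_sup : Continuous fun p : 𝒢.MS × 𝒢.MS => p.1 ⊔ p.2 := by
  refine continuous_of_eventually ?_
  rintro ⟨U, V⟩ g (hg | hg)
  · have h1 : Filter.Tendsto (fun p : (𝒢.MS × 𝒢.MS) × G => (p.1.1, p.2)) (𝓝 ((U, V), g))
        (𝓝 U ×ˢ 𝓝 g) := by
      rw [← nhds_prod_eq]
      exact Continuous.tendsto (by fun_prop) _
    filter_upwards [h1.eventually (eventually_mem hg)] with p hp using Or.inl hp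
  · have h1 : Filter.Tendsto (fun p : (𝒢.MS × 𝒢.MS) × G => (p.1.2, p.2)) (𝓝 ((U, V), g))
        (𝓝 V ×ˢ 𝓝 g) := by
      rw [← nhds_prod_eq]
      exact Continuous.tendsto (by fun_prop) _
    filter_upwards [h1.eventually (eventually_mem hg)] with p hp using Or.inr hp

theorem continuous_star : Continuous (star : 𝒢.MS → 𝒢.MS) := by
  refine continuous_of_eventually fun U g hg => ?_
  have h1 : Filter.Tendsto (fun p : 𝒢.MS × G => (p.1, 𝒢.inv p.2)) (𝓝 (U, g))
      (𝓝 U ×ˢ 𝓝 (𝒢.inv g)) := by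
    rw [← nhds_prod_eq]
    exact (continuous_fst.prodMk (𝒢.continuous_inv.comp continuous_snd)).tendsto (U, g)
  exact h1.eventually (eventually_mem hg)

theorem continuous_mul : Continuous fun p : 𝒢.MS × 𝒢.MS => p.1 * p.2 := by
  refine continuous_of_eventually ?_
  rintro ⟨U, V⟩ _ ⟨g, hg, h, hh, hgh, rfl⟩
  obtain ⟨K, hK, hgK, hKU⟩ := exists_compact_subset U.isOpen_coe hg
  obtain ⟨L, hL, hhL, hLV⟩ := exists_compact_subset V.isOpen_coe hh
  let K' : 𝒢.MS := ⟨interior K, isOpen_interior⟩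
  let L' : 𝒢.MS := ⟨interior L, isOpen_interior⟩
  have hmem : 𝒢.mul g h ∈ K' * L' := mul_mem_mul hgK hhL hgh
  filter_upwards [((eventually_superset hK hKU).prod_nhds
    (eventually_superset hL hLV)).prod_nhds ((K' * L').isOpen_coe.eventually_mem hmem)]
  rintro ⟨⟨A, B⟩, x⟩ ⟨⟨hA, hB⟩, hx⟩
  exact mul_le_mul (fun y hy => hA (interior_subset hy)) (fun y hy => hB (interior_subset hy)) hx

/-- The supremum of all open sets that are relatively compact in some member of `C`. Irreducibility
makes this family directed, and a Scott closed set is closed under directed suprema. -/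
theorem exists_generic {C : Set 𝒢.MS} (hC : IsIrreducible C) (hCc : IsClosed C) :
    ∃ P ∈ C, ∀ Q ∈ C, Q ≤ P := by
  have hcl := Topology.IsScott.isClosed_iff_isLowerSet_and_dirSupClosed.1 hCc
  set D : Set 𝒢.MS := {U | ∃ K : Set G, ∃ V ∈ C, IsCompact K ∧ (U : Set G) ⊆ K ∧ K ⊆ V}
  have hDC : D ⊆ C := by
    rintro U ⟨K, V, hV, -, hUK, hKV⟩
    exact hcl.1 (fun g hg => hKV (hUK hg)) hV
  have hne : D.Nonempty := by
    obtain ⟨V, hV⟩ := hC.1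
    exact ⟨⊥, ∅, V, hV, isCompact_empty, fun g hg => hg, Set.empty_subset _⟩
  have hdir : DirectedOn (· ≤ ·) D := by
    rintro A ⟨K, V, hV, hK, hA, hKV⟩ B ⟨L, W, hW, hL, hB, hLW⟩
    obtain ⟨Z, hZC, hKZ, hLZ⟩ := hC.2 _ _ (isOpen_setOf_superset hK) (isOpen_setOf_superset hL)
      ⟨V, hV, hKV⟩ ⟨W, hW, hLW⟩
    exact ⟨A ⊔ B, ⟨K ∪ L, Z, hZC, hK.union hL, Set.union_subset_union hA hB,
      Set.union_subset hKZ hLZ⟩, le_sup_left, le_sup_right⟩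
  refine ⟨sSup D, hcl.2 hDC hne hdir (isLUB_sSup D), fun Q hQ g hg => ?_⟩
  obtain ⟨K, hK, hgK, hKU⟩ := exists_compact_subset Q.isOpen_coe hg
  exact mem_sSup.2 ⟨⟨interior K, isOpen_interior⟩, ⟨K, Q, hQ, hK, interior_subset, hKU⟩, hgK⟩

theorem isSoberLattice : IsSoberLattice 𝒢.MS where
  t0 := inferInstance
  quasiSober := ⟨by
    intro C hC hCc
    obtain ⟨P, hP, hle⟩ := exists_generic hC hCc
    refine ⟨P, subset_antisymm (hCc.closure_subset_iff.2 (Set.singleton_subset_iff.2 hP)) ?_⟩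
    rw [Topology.IsScott.closure_singleton]
    exact hle⟩
  le_iff U V := by
    refine ⟨fun h s hs hU => Topology.IsScott.isUpperSet_of_isOpen (D := Set.univ) hs h hU,
      fun h => ?_⟩
    by_contra hc
    have := h (Set.Iic V)ᶜ isClosed_Iic.isOpen_compl hc
    exact this (Set.mem_Iic.2 le_rfl)
  continuous_sup := continuous_sup

theorem isMeasurementSpace : IsMeasurementSpace 𝒢.MS where
  toIsSoberLattice := isSoberLattice
  continuous_mul := continuous_mul
  continuous_star := continuous_star
  mul_assoc := mul_assoc_eq
  mul_bot := mul_bot_eq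
  mul_sup := mul_sup_eq
  star_star := star_star_eq
  star_mul := star_mul_eq
  stablyGelfand U _ := le_mul_star_mul U

theorem exists_countable_basis [SecondCountableTopology G] :
    ∃ B : Set 𝒢.MS, B.Countable ∧ ∀ U : 𝒢.MS, sSup {b ∈ B | IsWayBelow b U} = U := by
  refine ⟨{U : 𝒢.MS | (U : Set G) ∈ TopologicalSpace.countableBasis G},
    (TopologicalSpace.countable_countableBasis G).preimage SetLike.coe_injective, fun U => ?_⟩
  refine le_antisymm (sSup_le fun b hb => le_of_isWayBelow hb.2) fun g hg => ?_
  obtain ⟨K, hK, hgK, hKU⟩ := exists_compact_subset U.isOpen_coe hg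
  obtain ⟨V, hV, hgV, hVK⟩ := (TopologicalSpace.isBasis_countableBasis G).exists_subset_of_mem_open
    hgK isOpen_interior
  exact mem_sSup.2 ⟨⟨V, TopologicalSpace.isOpen_of_mem_countableBasis hV⟩, ⟨hV,
    isWayBelow_of_isCompact hK (hVK.trans interior_subset) hKU⟩, hgV⟩

theorem isClassicalMeasurementSpace [SecondCountableTopology G] :
    IsClassicalMeasurementSpace 𝒢.MS where
  toIsMeasurementSpace := isMeasurementSpace
  isScott := inferInstance
  inf_sSup := inf_sSup_eq
  continuousLattice U := by
    obtain ⟨B, -, hB⟩ := exists_countable_basis (𝒢 := 𝒢)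
    refine le_antisymm (sSup_le fun b hb => le_of_isWayBelow hb) ?_
    conv_lhs => rw [← hB U]
    exact sSup_le_sSup fun b hb => hb.2
  countablyBased := exists_countable_basis
  le_mul_star_mul := le_mul_star_mul

end LocallyCompact

end MS

end EtaleGroupoid

/-! ### Partitions of unity and bump functions in `C_c(G)` -/

section Bump

variable {G : Type*} [TopologicalSpace G] [T2Space G] [LocallyCompactSpace G]

/-- A compactly supported function is a sum of functions subordinate to an open cover of its
support. -/
theorem exists_sum_eq_of_tsupport_subset (f : C_c(G, ℂ)) {U : G → Set G} (hU : ∀ g, IsOpen (U g))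
    (hg : ∀ g ∈ tsupport f, g ∈ U g) :
    ∃ (n : ℕ) (φ : Fin n → C_c(G, ℂ)), f = ∑ i, φ i ∧
      ∀ i, ∃ g ∈ tsupport f, tsupport (φ i) ⊆ U g := by
  obtain ⟨t, htK, ht⟩ := f.hasCompactSupport'.isCompact.elim_nhds_subcover U
    (fun g h => (hU g).mem_nhds (hg g h))
  obtain ⟨φ, hφ, hsum, -, hc⟩ := exists_continuous_sum_one_of_isOpen_isCompact
    (s := fun i : Fin t.card => U (t.equivFin.symm i)) (fun i => hU _) f.hasCompactSupport'.isCompact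
    (fun x hx => by
      obtain ⟨g, hgt, hgx⟩ := Set.mem_iUnion₂.1 (ht hx)
      exact Set.mem_iUnion.2 ⟨t.equivFin ⟨g, hgt⟩, by simpa using hgx⟩)
  let ψ : Fin t.card → C_c(G, ℂ) := fun i =>
    { toFun := fun x => (φ i x : ℂ) * f x
      continuous_toFun := (Complex.continuous_ofReal.comp (φ i).continuous).mul f.continuous
      hasCompactSupport' := f.hasCompactSupport'.mul_left }
  refine ⟨t.card, ψ, ?_, fun i => ⟨_, htK _ (t.equivFin.symm i).2, ?_⟩⟩
  · ext x
    rw [CompactlySupportedContinuousMap.sum_apply]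
    change f x = ∑ i, (φ i x : ℂ) * f x
    by_cases hx : f x = 0
    · simp [hx]
    · have h1 : ∑ i, φ i x = 1 := by simpa using hsum (subset_tsupport f hx)
      rw [← Finset.sum_mul, ← Complex.ofReal_sum, h1, Complex.ofReal_one, one_mul]
  · refine (closure_mono fun x hx => ?_).trans (hφ i)
    exact fun h0 => hx (by change (φ i x : ℂ) * f x = 0; rw [h0, Complex.ofReal_zero, zero_mul])

theorem exists_bump {K U : Set G} (hK : IsCompact K) (hU : IsOpen U) (hKU : K ⊆ U) :
    ∃ f : C_c(G, ℂ), tsupport f ⊆ U ∧ (∀ x ∈ K, f x = 1) ∧ ∀ x, ‖f x‖ ≤ 1 := by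
  obtain ⟨φ, hφ, hsum, h01, hc⟩ := exists_continuous_sum_one_of_isOpen_isCompact
    (s := fun _ : Fin 1 => U) (fun i => hU) hK (fun x hx => Set.mem_iUnion.2 ⟨0, hKU hx⟩)
  refine ⟨⟨⟨fun x => (φ 0 x : ℂ), Complex.continuous_ofReal.comp (φ 0).continuous⟩,
    (hc 0).comp_left (g := Complex.ofReal) Complex.ofReal_zero⟩, ?_, fun x hx => ?_, fun x => ?_⟩
  · refine (closure_mono fun x hx => ?_).trans (hφ 0)
    exact fun h0 => hx (by change (φ 0 x : ℂ) = 0; rw [h0, Complex.ofReal_zero])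
  · have h1 := hsum hx
    simp only [Finset.univ_unique, Fin.default_eq_zero, Finset.sum_singleton, Pi.one_apply] at h1
    change (φ 0 x : ℂ) = 1
    rw [h1, Complex.ofReal_one]
  · change ‖(φ 0 x : ℂ)‖ ≤ 1
    rw [Complex.norm_real, Real.norm_of_nonneg (h01 0 x).1]
    exact (h01 0 x).2

theorem exists_bump_singleton {g : G} {U : Set G} (hU : IsOpen U) (hg : g ∈ U) :
    ∃ f : C_c(G, ℂ), tsupport f ⊆ U ∧ f g = 1 ∧ ∀ x, ‖f x‖ ≤ 1 := by
  obtain ⟨f, hf, h1, hn⟩ := exists_bump isCompact_singleton hU (Set.singleton_subset_iff.2 hg)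
  exact ⟨f, hf, h1 g rfl, hn⟩

end Bump

/-! ### Coefficient functions and convolution in the reduced C*-algebra -/

namespace EtaleGroupoid

variable {X G : Type*} [TopologicalSpace X] [TopologicalSpace G] [T2Space G]
  (𝒢 : EtaleGroupoid X G)

/-- The function on `G` that corresponds to an element of the reduced C*-algebra. -/
noncomputable def coeff (T : 𝒢.ReducedCStar) : G → ℂ :=
  𝒢.toFunction (T : EllTwo G →L[ℂ] EllTwo G)

/-- The element of the reduced C*-algebra given by a compactly supported function. -/
noncomputable def ofCc (f : C_c(G, ℂ)) : 𝒢.ReducedCStar :=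
  ⟨𝒢.regRep f, subset_closure ⟨f, rfl⟩⟩

theorem coeff_ofCc (f : C_c(G, ℂ)) : 𝒢.coeff (𝒢.ofCc f) = f := 𝒢.toFunction_regRep f

theorem ofCc_add (f g : C_c(G, ℂ)) : 𝒢.ofCc (f + g) = 𝒢.ofCc f + 𝒢.ofCc g :=
  Subtype.ext (𝒢.regRep_add f g)

theorem ofCc_zero : 𝒢.ofCc 0 = 0 := Subtype.ext 𝒢.regRep_zero

theorem ofCc_sum {n : ℕ} (φ : Fin n → C_c(G, ℂ)) : 𝒢.ofCc (∑ i, φ i) = ∑ i, 𝒢.ofCc (φ i) :=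
  map_sum (⟨⟨𝒢.ofCc, 𝒢.ofCc_zero⟩, 𝒢.ofCc_add⟩ : C_c(G, ℂ) →+ 𝒢.ReducedCStar) φ Finset.univ

theorem ofCc_conv (f g : C_c(G, ℂ)) : 𝒢.ofCc (𝒢.conv f g) = 𝒢.ofCc f * 𝒢.ofCc g :=
  Subtype.ext (𝒢.regRep_conv f g)

theorem ofCc_ccStar (f : C_c(G, ℂ)) : 𝒢.ofCc (𝒢.ccStar f) = star (𝒢.ofCc f) :=
  Subtype.ext (𝒢.regRep_ccStar f)

theorem dense_ofCc : DenseRange 𝒢.ofCc := by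
  intro T
  refine Metric.mem_closure_iff.2 fun ε hε => ?_
  obtain ⟨_, ⟨f, rfl⟩, hf⟩ := Metric.mem_closure_iff.1 T.2 ε hε
  exact ⟨𝒢.ofCc f, ⟨f, rfl⟩, hf⟩

theorem continuous_coeff (T : 𝒢.ReducedCStar) : Continuous (𝒢.coeff T) :=
  𝒢.continuous_toFunction T

theorem dist_coeff_le (S T : 𝒢.ReducedCStar) (g : G) :
    dist (𝒢.coeff S g) (𝒢.coeff T g) ≤ dist S T :=
  𝒢.dist_toFunction_le S T g

theorem continuous_coeff_apply (g : G) : Continuous fun T => 𝒢.coeff T g :=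
  (LipschitzWith.of_dist_le_mul (K := 1) fun S T => by
    simpa using 𝒢.dist_coeff_le S T g).continuous

/-- The evaluation of the elements of the reduced C*-algebra at an arrow. -/
noncomputable def coeffCLM (g : G) : 𝒢.ReducedCStar →L[ℂ] ℂ where
  toFun T := 𝒢.coeff T g
  map_add' _ _ := rfl
  map_smul' _ _ := rfl
  cont := 𝒢.continuous_coeff_apply g

theorem coeff_add (S T : 𝒢.ReducedCStar) (g : G) :
    𝒢.coeff (S + T) g = 𝒢.coeff S g + 𝒢.coeff T g := (𝒢.coeffCLM g).map_add S T

theorem coeff_sub (S T : 𝒢.ReducedCStar) (g : G) :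
    𝒢.coeff (S - T) g = 𝒢.coeff S g - 𝒢.coeff T g := (𝒢.coeffCLM g).map_sub S T

-- True on `C_c(G)`, and both sides are continuous in `T`. Consequently the coefficient function
-- determines all matrix entries, and so the operator.
open Classical in
theorem apply_single (T : 𝒢.ReducedCStar) (g k : G) :
    (T : EllTwo G →L[ℂ] EllTwo G) (lp.single 2 k (1 : ℂ)) g = 𝒢.kernel (𝒢.coeff T) g k := by
  have hl : Continuous fun T : 𝒢.ReducedCStar =>
      ((T : EllTwo G →L[ℂ] EllTwo G) (lp.single 2 k (1 : ℂ)) : EllTwo G) g :=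
    (lp.evalCLM ℂ (fun _ : G => ℂ) 2 g).continuous.comp
      (((ContinuousLinearMap.apply ℂ (EllTwo G)
        (lp.single 2 k (1 : ℂ) : EllTwo G)).continuous.comp continuous_subtype_val))
  have hr : Continuous fun T : 𝒢.ReducedCStar => 𝒢.kernel (𝒢.coeff T) g k := by
    by_cases h : 𝒢.d g = 𝒢.d k
    · simp only [𝒢.kernel_pos _ h]
      exact 𝒢.continuous_coeff_apply _
    · simp only [𝒢.kernel_neg _ h]
      exact continuous_const
  refine congrFun (𝒢.dense_ofCc.equalizer hl hr (funext fun f => ?_)) T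
  change 𝒢.regRep f (lp.single 2 k (1 : ℂ)) g = 𝒢.kernel (𝒢.coeff (𝒢.ofCc f)) g k
  rw [regRep_single, coeff_ofCc]

theorem coeff_injective : Function.Injective 𝒢.coeff := by
  classical
  intro S T h
  refine Subtype.ext (ellTwo_clm_ext fun g k => ?_)
  rw [apply_single, apply_single, h]

theorem coeff_star (T : 𝒢.ReducedCStar) (g : G) :
    𝒢.coeff (star T) g = star (𝒢.coeff T (𝒢.inv g)) := by
  have hl : Continuous fun T => 𝒢.coeff (star T) g :=
    (𝒢.continuous_coeff_apply g).comp continuous_star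
  have hr : Continuous fun T => star (𝒢.coeff T (𝒢.inv g)) :=
    (𝒢.continuous_coeff_apply _).star
  refine congrFun (𝒢.dense_ofCc.equalizer hl hr (funext fun f => ?_)) T
  change 𝒢.coeff (star (𝒢.ofCc f)) g = star (𝒢.coeff (𝒢.ofCc f) (𝒢.inv g))
  rw [← ofCc_ccStar, coeff_ofCc, coeff_ofCc]
  rfl

/-- The product of the reduced C*-algebra is given by convolution. -/
theorem hasSum_coeff_mul (S T : 𝒢.ReducedCStar) (x : G) :
    HasSum (fun k => 𝒢.kernel (𝒢.coeff S) x k * 𝒢.coeff T k) (𝒢.coeff (S * T) x) := by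
  classical
  -- The vector `T δ` for the unit at `d x` has the coefficients of `T` over that fibre; the sum
  -- arises by expanding it in the basis, applying `S` and evaluating at `x`.
  set ξ : EllTwo G := (T : EllTwo G →L[ℂ] EllTwo G) (lp.single 2 (𝒢.u (𝒢.d x)) (1 : ℂ))
  have h1 := ((lp.hasSum_single (p := 2) (by norm_num) ξ).mapL
    (S : EllTwo G →L[ℂ] EllTwo G)).mapL (lp.evalCLM ℂ (fun _ : G => ℂ) 2 x)
  have hξ : ∀ k, ξ k = 𝒢.kernel (𝒢.coeff T) k (𝒢.u (𝒢.d x)) := fun k => 𝒢.apply_single T k _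
  refine (congrArg (fun f => HasSum f _) (funext fun k => ?_)).mp h1
  change ((S : EllTwo G →L[ℂ] EllTwo G) (lp.single 2 k (ξ k)) : EllTwo G) x = _
  have h2 : (lp.single 2 k (ξ k) : EllTwo G) = ξ k • lp.single 2 k (1 : ℂ) := by
    rw [← lp.single_smul, smul_eq_mul, mul_one]
  rw [h2, map_smul, lp.coeFn_smul, Pi.smul_apply, smul_eq_mul, hξ, 𝒢.apply_single S x k, mul_comm]
  by_cases h : 𝒢.d x = 𝒢.d k
  · rw [h, 𝒢.kernel_u]
  · rw [𝒢.kernel_neg _ h, zero_mul, zero_mul]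

/-- The summation index `k = h` contributes `S(g) T(h)`; the assumption removes all other terms. -/
theorem coeff_mul_of_forall {S T : 𝒢.ReducedCStar} {g h : G} (hgh : 𝒢.d g = 𝒢.r h)
    (H : ∀ k, 𝒢.d k = 𝒢.d h → k ≠ h →
      𝒢.coeff S (𝒢.mul (𝒢.mul g h) (𝒢.inv k)) * 𝒢.coeff T k = 0) :
    𝒢.coeff (S * T) (𝒢.mul g h) = 𝒢.coeff S g * 𝒢.coeff T h := by
  have hd : 𝒢.d (𝒢.mul g h) = 𝒢.d h := 𝒢.d_mul _ _ hgh
  have h2 := hasSum_single (f := fun k => 𝒢.kernel (𝒢.coeff S) (𝒢.mul g h) k * 𝒢.coeff T k) h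
    fun k hk => by
      by_cases hdk : 𝒢.d k = 𝒢.d h
      · simp only [𝒢.kernel_pos _ (hd.trans hdk.symm)]
        exact H k hdk hk
      · simp only [𝒢.kernel_neg _ (fun e => hdk (e.symm.trans hd)), zero_mul]
  rw [(𝒢.hasSum_coeff_mul S T _).unique h2, 𝒢.kernel_pos _ hd, 𝒢.mul_mul_inv_cancel hgh]

/-- The convolution has one term only if the support of the right factor meets the relevant fibre
of `d` in one point. -/
theorem coeff_mul_right {S T : 𝒢.ReducedCStar} {g h : G} (hgh : 𝒢.d g = 𝒢.r h)
    (hT : ∀ k, 𝒢.d k = 𝒢.d h → 𝒢.coeff T k ≠ 0 → k = h) :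
    𝒢.coeff (S * T) (𝒢.mul g h) = 𝒢.coeff S g * 𝒢.coeff T h := by
  refine 𝒢.coeff_mul_of_forall hgh fun k hk hkh => ?_
  rw [not_imp_comm.1 (hT k hk) hkh, mul_zero]

/-- The convolution has one term only if the support of the left factor meets the relevant fibre
of `r` in one point. -/
theorem coeff_mul_left {S T : 𝒢.ReducedCStar} {g h : G} (hgh : 𝒢.d g = 𝒢.r h)
    (hS : ∀ k, 𝒢.r k = 𝒢.r g → 𝒢.coeff S k ≠ 0 → k = g) :
    𝒢.coeff (S * T) (𝒢.mul g h) = 𝒢.coeff S g * 𝒢.coeff T h := by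
  refine 𝒢.coeff_mul_of_forall hgh fun k hk hkh => ?_
  have hd : 𝒢.d (𝒢.mul g h) = 𝒢.d k := (𝒢.d_mul _ _ hgh).trans hk.symm
  by_contra hne
  have e := hS _ (by rw [𝒢.r_mul _ _ (by rw [𝒢.r_inv, hd]), 𝒢.r_mul _ _ hgh])
    (left_ne_zero_of_mul hne)
  -- Both sides equal `g`; inverting and cancelling `g h` forces `k = h`.
  have e2 : 𝒢.mul (𝒢.mul g h) (𝒢.inv k) = 𝒢.mul (𝒢.mul g h) (𝒢.inv h) := by
    rw [e, 𝒢.mul_mul_inv_cancel hgh]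
  have e3 := congrArg 𝒢.inv e2
  rw [𝒢.inv_mul_inv hd, 𝒢.inv_mul_inv (𝒢.d_mul _ _ hgh)] at e3
  rw [← 𝒢.mul_inv_mul_cancel hd.symm, e3, 𝒢.mul_inv_mul_cancel (𝒢.d_mul _ _ hgh).symm] at hkh
  exact hkh rfl

/-- If a product does not vanish at `x`, then neither do the factors at suitable `g` and `h` with
`x = g h`. -/
theorem exists_of_coeff_mul_ne_zero {S T : 𝒢.ReducedCStar} {x : G} (hx : 𝒢.coeff (S * T) x ≠ 0) :
    ∃ g h, 𝒢.d g = 𝒢.r h ∧ 𝒢.mul g h = x ∧ 𝒢.coeff S g ≠ 0 ∧ 𝒢.coeff T h ≠ 0 := by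
  by_contra! hc
  refine hx ((𝒢.hasSum_coeff_mul S T x).unique
    ((congrArg (fun f => HasSum f (0 : ℂ)) (funext fun k => ?_)).mpr hasSum_zero))
  by_cases hd : 𝒢.d x = 𝒢.d k
  · rw [𝒢.kernel_pos _ hd]
    by_cases h0 : 𝒢.coeff S (𝒢.mul x (𝒢.inv k)) = 0
    · rw [h0, zero_mul]
    · rw [hc _ k ?_ (𝒢.mul_inv_mul_cancel hd) h0, mul_zero]
      rw [𝒢.d_mul _ _ (by rw [𝒢.r_inv, hd]), 𝒢.d_inv]
  · rw [𝒢.kernel_neg _ hd, zero_mul]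

/-- The products of composable pairs from the two supports form a compact, hence closed, set that
contains the open support of the convolution. -/
theorem tsupport_conv_subset (f g : C_c(G, ℂ)) {x : G} (hx : x ∈ tsupport (𝒢.conv f g)) :
    ∃ a ∈ tsupport f, ∃ b ∈ tsupport g, 𝒢.d a = 𝒢.r b ∧ 𝒢.mul a b = x := by
  have : T2Space X := 𝒢.t2Space
  have hcl : IsClosed {p : G × G | 𝒢.d p.1 = 𝒢.r p.2} :=
    isClosed_eq (𝒢.continuous_d.comp continuous_fst) (𝒢.continuous_r.comp continuous_snd)
  have hK := ((f.hasCompactSupport'.isCompact.prod g.hasCompactSupport'.isCompact).inter_right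
    hcl).image_of_continuousOn (𝒢.continuousOn_mul.mono Set.inter_subset_right)
  have hsub : Function.support (𝒢.conv f g) ⊆ _ := fun y hy => by
    rw [Function.mem_support, ← 𝒢.coeff_ofCc, ofCc_conv] at hy
    obtain ⟨a, b, hab, hy, ha, hb⟩ := 𝒢.exists_of_coeff_mul_ne_zero hy
    rw [coeff_ofCc] at ha hb
    exact (⟨(a, b), ⟨⟨subset_tsupport f ha, subset_tsupport g hb⟩, hab⟩, hy⟩ :
      y ∈ (fun p : G × G => 𝒢.mul p.1 p.2) ''
        ((tsupport f ×ˢ tsupport g) ∩ {p | 𝒢.d p.1 = 𝒢.r p.2}))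
  obtain ⟨⟨a, b⟩, ⟨⟨ha, hb⟩, hab⟩, e⟩ := closure_minimal hsub hK.isClosed hx
  exact ⟨a, ha, b, hb, hab, e⟩

theorem inv_mem_tsupport_of_ccStar (f : C_c(G, ℂ)) {x : G} (hx : x ∈ tsupport (𝒢.ccStar f)) :
    𝒢.inv x ∈ tsupport f := by
  refine closure_minimal (t := 𝒢.inv ⁻¹' tsupport f) (fun y hy => ?_)
    ((isClosed_tsupport f).preimage 𝒢.continuous_inv) hx
  refine subset_tsupport f fun h0 => hy ?_
  change star (f (𝒢.inv y)) = 0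
  rw [h0, star_zero]

end EtaleGroupoid

/-! ### Closed subspaces used for testing inclusions -/

namespace MaxSpace

variable {A : Type*} [NonUnitalCStarAlgebra A]

/-- The elements `x` with `x c ∈ P`. -/
noncomputable def comapMulRight (P : MaxSpace A) (c : A) : MaxSpace A :=
  ClosedSubmodule.comap ((ContinuousLinearMap.mul ℂ A).flip c) P

theorem mem_comapMulRight {P : MaxSpace A} {c x : A} : x ∈ P.comapMulRight c ↔ x * c ∈ P := Iff.rfl

/-- The elements `x` with `c x ∈ P`. -/
noncomputable def comapMulLeft (P : MaxSpace A) (c : A) : MaxSpace A :=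
  ClosedSubmodule.comap (ContinuousLinearMap.mul ℂ A c) P

theorem mem_comapMulLeft {P : MaxSpace A} {c x : A} : x ∈ P.comapMulLeft c ↔ c * x ∈ P := Iff.rfl

/-- The kernel of a continuous functional. -/
noncomputable def ofKer (φ : A →L[ℂ] ℂ) : MaxSpace A := ClosedSubmodule.comap φ ⊥

/-- The closed linear span of an element. -/
noncomputable def span (a : A) : MaxSpace A := (Submodule.span ℂ {a}).closure

theorem mem_span_self (a : A) : a ∈ span a := subset_closure (Submodule.mem_span_singleton_self a)

theorem span_le {a : A} {P : MaxSpace A} : span a ≤ P ↔ a ∈ P :=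
  Submodule.closure_le.trans (Submodule.span_singleton_le_iff_mem a P.toSubmodule)

theorem sum_mem (P : MaxSpace A) {n : ℕ} {f : Fin n → A} (h : ∀ i, f i ∈ P) : ∑ i, f i ∈ P :=
  P.toSubmodule.sum_mem fun i _ => h i

end MaxSpace

/-! ### The associated observer -/

namespace EtaleGroupoid

variable {X G : Type*} [TopologicalSpace X] [TopologicalSpace G] [T2Space G]
  (𝒢 : EtaleGroupoid X G)

theorem assocEmb_le {U : 𝒢.MS} {P : MaxSpace 𝒢.ReducedCStar} :
    𝒢.assocEmb U ≤ P ↔ ∀ f : C_c(G, ℂ), tsupport f ⊆ U → 𝒢.ofCc f ∈ P := by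
  refine (Submodule.closure_le (t := P)).trans ⟨fun h f hf => h ⟨f, hf, rfl⟩, ?_⟩
  rintro h T ⟨f, hf, hT⟩
  rw [show T = 𝒢.ofCc f from Subtype.ext hT]
  exact h f hf

theorem ofCc_mem_assocEmb {U : 𝒢.MS} {f : C_c(G, ℂ)} (hf : tsupport f ⊆ U) :
    𝒢.ofCc f ∈ 𝒢.assocEmb U := 𝒢.assocEmb_le.1 le_rfl f hf

theorem assocEmb_mono {U V : 𝒢.MS} (h : U ≤ V) : 𝒢.assocEmb U ≤ 𝒢.assocEmb V :=
  𝒢.assocEmb_le.2 fun _ hf => 𝒢.ofCc_mem_assocEmb fun _ hx => h (hf hx)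

theorem mem_assocRet {P : MaxSpace 𝒢.ReducedCStar} {g : G} :
    g ∈ 𝒢.assocRet P ↔ ∃ T ∈ P, 𝒢.coeff T g ≠ 0 := by
  change g ∈ ⋃ T ∈ P, {g | 𝒢.toFunction (T : EllTwo G →L[ℂ] EllTwo G) g ≠ 0} ↔ _
  simp only [Set.mem_iUnion, Set.mem_ofPred_eq, exists_prop]
  rfl

/-- The elements of the reduced C*-algebra that vanish at `g`. -/
noncomputable def vanishingAt (g : G) : MaxSpace 𝒢.ReducedCStar := MaxSpace.ofKer (𝒢.coeffCLM g)

theorem mem_vanishingAt {g : G} {T : 𝒢.ReducedCStar} :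
    T ∈ 𝒢.vanishingAt g ↔ 𝒢.coeff T g = 0 := Iff.rfl

/-- Turns questions about `ρ` into inclusions in a closed subspace, so that closures and spans need
no separate treatment. -/
theorem le_vanishingAt {P : MaxSpace 𝒢.ReducedCStar} {g : G} :
    P ≤ 𝒢.vanishingAt g ↔ g ∉ 𝒢.assocRet P := by
  rw [mem_assocRet]
  push Not
  exact Iff.rfl

theorem assocRet_sup (P Q : MaxSpace 𝒢.ReducedCStar) :
    𝒢.assocRet (P ⊔ Q) = 𝒢.assocRet P ⊔ 𝒢.assocRet Q := by
  refine SetLike.ext fun g => not_iff_not.1 ?_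
  rw [← le_vanishingAt, sup_le_iff, le_vanishingAt, le_vanishingAt, MS.mem_sup, not_or]

theorem assocRet_bot : 𝒢.assocRet ⊥ = ⊥ :=
  SetLike.ext fun g => not_iff_not.1 (by
    rw [← le_vanishingAt, MS.mem_bot]
    simp)

theorem assocRet_mul_le (P Q : MaxSpace 𝒢.ReducedCStar) :
    𝒢.assocRet (P * Q) ≤ 𝒢.assocRet P * 𝒢.assocRet Q := by
  intro x hx
  by_contra hc
  refine 𝒢.le_vanishingAt.1 (MaxSpace.mul_le.2 fun S hS T hT => ?_) hx
  by_contra hne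
  obtain ⟨g, h, hgh, rfl, hg, hh⟩ := 𝒢.exists_of_coeff_mul_ne_zero hne
  exact hc (MS.mul_mem_mul (𝒢.mem_assocRet.2 ⟨S, hS, hg⟩) (𝒢.mem_assocRet.2 ⟨T, hT, hh⟩) hgh)

theorem assocRet_star (P : MaxSpace 𝒢.ReducedCStar) :
    𝒢.assocRet (star P) = star (𝒢.assocRet P) := by
  refine SetLike.ext fun g => ?_
  rw [MS.mem_star, mem_assocRet, mem_assocRet]
  constructor
  · rintro ⟨T, hT, hg⟩
    refine ⟨star T, hT, ?_⟩
    rwa [coeff_star, 𝒢.inv_inv, star_ne_zero]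
  · rintro ⟨T, hT, hg⟩
    refine ⟨star T, by rwa [MaxSpace.mem_star, star_star], ?_⟩
    rwa [coeff_star, star_ne_zero]

/-- A compactly supported function with support in `U` belongs to a closed subspace as soon as
this holds for all functions with sufficiently small supports. -/
theorem ofCc_mem_of_locally [LocallyCompactSpace G] {P : MaxSpace 𝒢.ReducedCStar} {f : C_c(G, ℂ)}
    (h : ∀ g ∈ tsupport f, ∃ V : 𝒢.MS, g ∈ V ∧
      ∀ f' : C_c(G, ℂ), tsupport f' ⊆ V → 𝒢.ofCc f' ∈ P) : 𝒢.ofCc f ∈ P := by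
  choose! V hgV hV using h
  obtain ⟨n, φ, hφ, hs⟩ := exists_sum_eq_of_tsupport_subset f (fun g => (V g).isOpen_coe) hgV
  rw [hφ, ofCc_sum]
  refine P.sum_mem fun i => ?_
  obtain ⟨g, hg, hgi⟩ := hs i
  exact hV g hg _ hgi

theorem assocEmb_bot : 𝒢.assocEmb ⊥ = ⊥ := by
  refine le_bot_iff.1 (𝒢.assocEmb_le.2 fun f hf => ?_)
  have : f = 0 := by
    ext x
    by_contra hne
    exact hf (subset_tsupport f hne)
  rw [this, ofCc_zero]
  exact MaxSpace.zero_mem _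

/-- A partition of unity splits a function supported in the union into pieces supported in one of
the two open sets. -/
theorem assocEmb_sup [LocallyCompactSpace G] (U V : 𝒢.MS) :
    𝒢.assocEmb (U ⊔ V) = 𝒢.assocEmb U ⊔ 𝒢.assocEmb V := by
  refine le_antisymm (𝒢.assocEmb_le.2 fun f hf => 𝒢.ofCc_mem_of_locally fun g hg => ?_)
    (sup_le (𝒢.assocEmb_mono le_sup_left) (𝒢.assocEmb_mono le_sup_right))
  rcases MS.mem_sup.1 (hf hg) with hgU | hgV
  · exact ⟨U, hgU, fun f' hf' => (le_sup_left : 𝒢.assocEmb U ≤ _) (𝒢.ofCc_mem_assocEmb hf')⟩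
  · exact ⟨V, hgV, fun f' hf' =>
      (le_sup_right : 𝒢.assocEmb V ≤ 𝒢.assocEmb U ⊔ _) (𝒢.ofCc_mem_assocEmb hf')⟩

theorem assocEmb_star (U : 𝒢.MS) : 𝒢.assocEmb (star U) = star (𝒢.assocEmb U) := by
  have key : ∀ V : 𝒢.MS, 𝒢.assocEmb (star V) ≤ star (𝒢.assocEmb V) := by
    refine fun V => 𝒢.assocEmb_le.2 fun f hf => ?_
    rw [MaxSpace.mem_star, ← ofCc_ccStar]
    refine 𝒢.ofCc_mem_assocEmb fun x hx => ?_
    have := MS.mem_star.1 (hf (𝒢.inv_mem_tsupport_of_ccStar f hx))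
    rwa [𝒢.inv_inv] at this
  refine le_antisymm (key U) (MaxSpace.star_le.2 ?_)
  have := key (star U)
  rwa [MS.star_star_eq] at this

/-- A factorization of functions that are supported in a product of two bisections. -/
theorem ofCc_mem_mul_of_injOn [LocallyCompactSpace G] {U V : 𝒢.MS}
    (hd : Set.InjOn 𝒢.d (V : Set G)) (hr : Set.InjOn 𝒢.r (V : Set G))
    {f : C_c(G, ℂ)} (hf : tsupport f ⊆ (U * V : 𝒢.MS)) :
    𝒢.ofCc f ∈ 𝒢.assocEmb U * 𝒢.assocEmb V := by
  -- Since `d` is open, finitely many compact subsets of `V` have `d`-images covering the domains of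
  -- the support of `f`.
  obtain ⟨K, hK, hKV, hfK⟩ : ∃ K : Set G, IsCompact K ∧ K ⊆ V ∧
      ∀ x ∈ tsupport f, ∃ k ∈ K, 𝒢.d k = 𝒢.d x := by
    have hloc : ∀ x ∈ tsupport f, ∃ L : Set G, IsCompact L ∧ L ⊆ V ∧
        𝒢.d ⁻¹' (𝒢.d '' interior L) ∈ 𝓝 x := by
      intro x hx
      obtain ⟨g, hg, h, hh, hgh, rfl⟩ := hf hx
      obtain ⟨L, hL, hhL, hLV⟩ := exists_compact_subset V.isOpen_coe hh
      refine ⟨L, hL, hLV, 𝒢.continuous_d.continuousAt.preimage_mem_nhds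
        ((𝒢.isLocalHomeomorph_d.isOpenMap _ isOpen_interior).mem_nhds ⟨h, hhL, (𝒢.d_mul _ _ hgh).symm⟩)⟩
    choose! L hL hLV hLx using hloc
    obtain ⟨t, ht, hcov⟩ := f.hasCompactSupport'.isCompact.elim_nhds_subcover _ hLx
    refine ⟨⋃ x ∈ t, L x, t.isCompact_biUnion fun x hx => hL x (ht x hx),
      Set.iUnion₂_subset fun x hx => hLV x (ht x hx), fun x hx => ?_⟩
    obtain ⟨y, hy, k, hk, hkx⟩ := Set.mem_iUnion₂.1 (hcov hx)
    exact ⟨k, Set.mem_iUnion₂.2 ⟨y, hy, interior_subset hk⟩, hkx⟩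
  obtain ⟨b, hbV, hbK, -⟩ := exists_bump hK V.isOpen_coe hKV
  have hbV' : ∀ k, b k ≠ 0 → k ∈ V := fun k hk => hbV (subset_tsupport b hk)
  -- As `r` is injective on `V`, the product `b* b` lives on the units. It takes the value `1` at
  -- the units over `K`, so right multiplication by it fixes `f`.
  have hunit : ∀ k, 𝒢.coeff (star (𝒢.ofCc b) * 𝒢.ofCc b) k ≠ 0 → k = 𝒢.u (𝒢.d k) := by
    intro k hk
    obtain ⟨g, h, hgh, rfl, hg, hh⟩ := 𝒢.exists_of_coeff_mul_ne_zero hk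
    rw [coeff_star, star_ne_zero, coeff_ofCc] at hg
    rw [coeff_ofCc] at hh
    obtain ⟨x, hx⟩ := MS.star_mul_le_one hr (MS.mul_mem_mul (MS.mem_star.2 (hbV' _ hg))
      (hbV' _ hh) hgh)
    rw [← hx, 𝒢.d_u]
  have hone : ∀ k ∈ K, 𝒢.coeff (star (𝒢.ofCc b) * 𝒢.ofCc b) (𝒢.u (𝒢.d k)) = 1 := by
    intro k hk
    rw [← 𝒢.inv_mul k, coeff_mul_right, coeff_star, 𝒢.inv_inv, coeff_ofCc, hbK k hk]
    · simp
    · exact 𝒢.d_inv k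
    · intro l hl hl0
      rw [coeff_ofCc] at hl0
      exact hd (hbV' l hl0) (hKV hk) hl
  have hfac : 𝒢.ofCc f = 𝒢.ofCc f * star (𝒢.ofCc b) * 𝒢.ofCc b := by
    rw [mul_assoc]
    refine 𝒢.coeff_injective (funext fun x => ?_)
    have h1 := 𝒢.coeff_mul_right (S := 𝒢.ofCc f) (T := star (𝒢.ofCc b) * 𝒢.ofCc b)
      (𝒢.r_u (𝒢.d x)).symm (fun k hk hk0 => by rw [hunit k hk0, hk, 𝒢.d_u])
    rw [𝒢.mul_u] at h1
    rw [h1, coeff_ofCc]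
    by_cases hx : f x = 0
    · rw [hx, zero_mul]
    · obtain ⟨k, hk, hkx⟩ := hfK x (subset_tsupport f hx)
      rw [← hkx, hone k hk, mul_one]
  rw [hfac, ← ofCc_ccStar, ← ofCc_conv]
  refine MaxSpace.mul_mem_mul (𝒢.ofCc_mem_assocEmb fun x hx => ?_) (𝒢.ofCc_mem_assocEmb hbV)
  obtain ⟨a, ha, c, hc, hac, rfl⟩ := 𝒢.tsupport_conv_subset f _ hx
  -- The support of `f b*` lies in `U V V*`, hence in `U`, because `d` is injective on `V`.
  have h1 : 𝒢.mul a c ∈ U * V * star V :=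
    MS.mul_mem_mul (hf ha) (MS.mem_star.2 (hbV (𝒢.inv_mem_tsupport_of_ccStar b hc))) hac
  rw [MS.mul_assoc_eq] at h1
  have h2 := MS.mul_le_mul (le_refl U) (MS.mul_star_le_one hd) h1
  rwa [MS.mul_one_eq] at h2

theorem assocEmb_mul [LocallyCompactSpace G] (U V : 𝒢.MS) :
    𝒢.assocEmb (U * V) = 𝒢.assocEmb U * 𝒢.assocEmb V := by
  refine le_antisymm (𝒢.assocEmb_le.2 fun f hf => 𝒢.ofCc_mem_of_locally fun x hx => ?_)
    (MaxSpace.mul_le.2 fun S hS T hT => ?_)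
  · obtain ⟨g, hg, h, hh, hgh, rfl⟩ := hf hx
    obtain ⟨W, hhW, hWV, hd, hr⟩ := MS.exists_bisection V hh
    -- Only the right factor has to be shrunk to a bisection.
    exact ⟨U * W, MS.mul_mem_mul hg hhW hgh, fun f' hf' =>
      MaxSpace.mul_le_mul le_rfl (𝒢.assocEmb_mono hWV) (𝒢.ofCc_mem_mul_of_injOn hd hr hf')⟩
  · have h1 : 𝒢.assocEmb U ≤ (𝒢.assocEmb (U * V)).comapMulRight T := by
      refine 𝒢.assocEmb_le.2 fun f hf => ?_
      have h2 : 𝒢.assocEmb V ≤ (𝒢.assocEmb (U * V)).comapMulLeft (𝒢.ofCc f) := by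
        refine 𝒢.assocEmb_le.2 fun f' hf' => ?_
        rw [MaxSpace.mem_comapMulLeft, ← ofCc_conv]
        refine 𝒢.ofCc_mem_assocEmb fun x hx => ?_
        obtain ⟨a, ha, c, hc, hac, rfl⟩ := 𝒢.tsupport_conv_subset f f' hx
        exact MS.mul_mem_mul (hf ha) (hf' hc) hac
      exact h2 hT
    exact h1 hS

theorem continuous_assocEmb : Continuous 𝒢.assocEmb := by
  refine MaxSpace.continuous_of_eventually fun U T hT W hW hTW => ?_
  obtain ⟨S, hSW, f, hf, hS⟩ := mem_closure_iff.1 (MaxSpace.mem_closure.1 hT) W hW hTW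
  filter_upwards [MS.eventually_superset f.hasCompactSupport'.isCompact hf] with V hV
  refine ⟨S, ?_, hSW⟩
  rw [show S = 𝒢.ofCc f from Subtype.ext hS]
  exact 𝒢.ofCc_mem_assocEmb hV

/-- Coefficients are bounded by the norm and continuous in the arrow, so a nonzero value survives a
small change of both the element and the arrow. -/
theorem continuous_assocRet [LocallyCompactSpace G] : Continuous 𝒢.assocRet := by
  refine MS.continuous_of_eventually fun P g hg => ?_
  obtain ⟨T, hT, hTg⟩ := 𝒢.mem_assocRet.1 hg
  set ε := ‖𝒢.coeff T g‖ / 2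
  have hε : 0 < ε := half_pos (norm_pos_iff.2 hTg)
  have h1 : ∀ᶠ g' in 𝓝 g, ε < ‖𝒢.coeff T g'‖ :=
    (𝒢.continuous_coeff T).norm.continuousAt.eventually_const_lt
      (half_lt_self (norm_pos_iff.2 hTg))
  filter_upwards [(MaxSpace.eventually_meets hT Metric.isOpen_ball
    (Metric.mem_ball_self hε)).prod_nhds h1]
  rintro ⟨P', g'⟩ ⟨⟨S, hS, hST⟩, hg'⟩
  refine 𝒢.mem_assocRet.2 ⟨S, hS, fun h0 => ?_⟩
  have h2 := (𝒢.dist_coeff_le S T g').trans_lt (Metric.mem_ball.1 hST)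
  rw [h0, dist_zero_left] at h2
  exact lt_asymm h2 hg'

theorem assocRet_assocEmb [LocallyCompactSpace G] (U : 𝒢.MS) :
    𝒢.assocRet (𝒢.assocEmb U) = U := by
  refine SetLike.ext fun g => ⟨fun hg => ?_, fun hg => ?_⟩
  · by_contra hgU
    refine 𝒢.le_vanishingAt.1 (𝒢.assocEmb_le.2 fun f hf => ?_) hg
    rw [mem_vanishingAt, coeff_ofCc]
    by_contra h0
    exact hgU (hf (subset_tsupport f h0))
  · obtain ⟨f, hf, h1, -⟩ := exists_bump_singleton U.isOpen_coe hg
    refine 𝒢.mem_assocRet.2 ⟨_, 𝒢.ofCc_mem_assocEmb hf, ?_⟩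
    rw [coeff_ofCc, h1]
    exact one_ne_zero

/-- For every arrow of `U` there is an element of `C_c(U)` with value `1` at this arrow and with
support in an open bisection. -/
theorem exists_bump_bisection [LocallyCompactSpace G] {U : 𝒢.MS} {h : G} (hh : h ∈ U) :
    ∃ f : C_c(G, ℂ), tsupport f ⊆ U ∧ f h = 1 ∧ (∀ k, 𝒢.d k = 𝒢.d h → f k ≠ 0 → k = h) ∧
      (∀ k, 𝒢.r k = 𝒢.r h → f k ≠ 0 → k = h) := by
  obtain ⟨W, hhW, hWU, hd, hr⟩ := MS.exists_bisection U hh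
  obtain ⟨f, hf, h1, -⟩ := exists_bump_singleton W.isOpen_coe hhW
  exact ⟨f, fun x hx => hWU (hf hx), h1, fun k hk hk0 => hd (hf (subset_tsupport f hk0)) hhW hk,
    fun k hk hk0 => hr (hf (subset_tsupport f hk0)) hhW hk⟩

theorem assocRet_mul_assocEmb [LocallyCompactSpace G] (P : MaxSpace 𝒢.ReducedCStar) (U : 𝒢.MS) :
    𝒢.assocRet (P * 𝒢.assocEmb U) = 𝒢.assocRet P * U := by
  refine le_antisymm ?_ ?_
  · have h := 𝒢.assocRet_mul_le P (𝒢.assocEmb U)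
    rwa [assocRet_assocEmb] at h
  · rintro _ ⟨g, hg, h, hh, hgh, rfl⟩
    obtain ⟨T, hT, hTg⟩ := 𝒢.mem_assocRet.1 hg
    obtain ⟨f, hf, h1, hd, -⟩ := 𝒢.exists_bump_bisection hh
    refine 𝒢.mem_assocRet.2 ⟨_, MaxSpace.mul_mem_mul hT (𝒢.ofCc_mem_assocEmb hf), ?_⟩
    rw [𝒢.coeff_mul_right hgh (by rwa [coeff_ofCc]), coeff_ofCc, h1, mul_one]
    exact hTg

theorem isObserver [LocallyCompactSpace G] : IsObserver 𝒢.assocEmb 𝒢.assocRet where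
  measurementSpace := MaxSpace.isMeasurementSpace
  measurementSpace' := MS.isMeasurementSpace
  emb_hom :=
    { continuous := 𝒢.continuous_assocEmb
      map_sup := 𝒢.assocEmb_sup
      map_bot := 𝒢.assocEmb_bot
      map_mul := 𝒢.assocEmb_mul
      map_star := 𝒢.assocEmb_star }
  ret_hom :=
    { continuous := 𝒢.continuous_assocRet
      map_sup := 𝒢.assocRet_sup
      map_bot := 𝒢.assocRet_bot }
  ret_emb := 𝒢.assocRet_assocEmb
  ret_star := 𝒢.assocRet_star
  ret_mul_emb := 𝒢.assocRet_mul_assocEmb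

end EtaleGroupoid

/-! ### Trivial isotropy and separation of the terms of a series -/

namespace TopGroupoid

variable {X G : Type*} [TopologicalSpace X] [TopologicalSpace G] (𝒢 : TopGroupoid X G)

/-- Arrows with the same domain and range are equal if the isotropy at the domain is trivial. -/
theorem TrivialIsotropyAt.eq {𝒢 : TopGroupoid X G} {g h : G} (hx : 𝒢.TrivialIsotropyAt (𝒢.d g))
    (hd : 𝒢.d h = 𝒢.d g) (hr : 𝒢.r h = 𝒢.r g) : h = g := by
  have hc : 𝒢.d (𝒢.inv g) = 𝒢.r h := by rw [𝒢.d_inv, hr]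
  have h1 := hx (𝒢.mul (𝒢.inv g) h) (by rw [𝒢.d_mul _ _ hc, hd]) (by rw [𝒢.r_mul _ _ hc, 𝒢.r_inv])
  have h2 := 𝒢.inv_mul_cancel_left hc
  rw [𝒢.inv_inv, h1, 𝒢.mul_u] at h2
  exact h2.symm

end TopGroupoid

/-- If a summable family becomes `0`-summable after multiplication by arbitrary functions that are
`1` at `i` and vanish at finitely many other indices, then its entry at `i` is `0`. -/
theorem eq_zero_of_forall_hasSum_mul {ι : Type*} {a : ι → ℂ} (ha : Summable a) (i : ι)
    (H : ∀ F : Finset ι, i ∉ F → ∃ c : ι → ℂ, c i = 1 ∧ (∀ k, ‖c k‖ ≤ 1) ∧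
      (∀ k ∈ F, c k * a k = 0) ∧ HasSum (fun k => c k * a k) 0) : a i = 0 := by
  classical
  by_contra hne
  have han : Summable fun k => ‖a k‖ := ha.norm
  -- `F` is chosen so that the tail outside it has norm sum below `‖a i‖`. With the entries in `F`
  -- other than `i` killed, the zero sum makes `a i` minus a tail, which is too small.
  obtain ⟨F, hF⟩ := ((tendsto_order.1 (tendsto_tsum_compl_atTop_zero fun k => ‖a k‖)).2 ‖a i‖
    (norm_pos_iff.2 hne)).exists_forall_of_atTop
  have hF' := hF (insert i F) (Finset.subset_insert i F)
  obtain ⟨c, hci, hc1, hcF, hsum⟩ := H (F.erase i) (Finset.notMem_erase i F)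
  have h1 := hsum.summable.sum_add_tsum_compl (s := insert i F)
  rw [hsum.tsum_eq, Finset.sum_eq_single_of_mem i (Finset.mem_insert_self i F) fun k hk hki =>
    hcF k (Finset.mem_erase.2 ⟨hki, (Finset.mem_insert.1 hk).resolve_left hki⟩), hci, one_mul] at h1
  have h2 : ‖a i‖ ≤ ∑' k : {k // k ∉ insert i F}, ‖a k‖ := by
    rw [eq_neg_of_add_eq_zero_left h1, norm_neg]
    refine tsum_of_norm_bounded (han.subtype _).hasSum fun k => ?_
    rw [norm_mul]
    exact mul_le_of_le_one_left (norm_nonneg _) (hc1 k)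
  exact absurd hF' (not_lt.2 h2)

/-! ### Persistence, principality and `I`-stability -/

namespace EtaleGroupoid

variable {X G : Type*} [TopologicalSpace X] [TopologicalSpace G] [T2Space G]
  (𝒢 : EtaleGroupoid X G)

theorem isClosed_range_u : IsClosed (Set.range 𝒢.u) := by
  have : Set.range 𝒢.u = {g | 𝒢.u (𝒢.d g) = g} := by
    ext g
    refine ⟨?_, fun h => ⟨_, h⟩⟩
    rintro ⟨x, rfl⟩
    exact congrArg 𝒢.u (𝒢.d_u x)
  rw [this]
  exact isClosed_eq (𝒢.continuous_u.comp 𝒢.continuous_d) continuous_id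

/-- The product with a function that is supported on the units. -/
theorem coeff_ofCc_mul_of_units {f : C_c(G, ℂ)} (hf : tsupport f ⊆ (1 : 𝒢.MS))
    (T : 𝒢.ReducedCStar) (k : G) :
    𝒢.coeff (𝒢.ofCc f * T) k = f (𝒢.u (𝒢.r k)) * 𝒢.coeff T k := by
  have h := 𝒢.coeff_mul_left (S := 𝒢.ofCc f) (T := T) (𝒢.d_u (𝒢.r k)) fun l hl hl0 => by
    rw [coeff_ofCc] at hl0
    obtain ⟨x, rfl⟩ := hf (subset_tsupport f hl0)
    rw [𝒢.r_u, 𝒢.r_u] at hl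
    rw [hl]
  rwa [𝒢.u_mul, coeff_ofCc] at h

theorem assocRet_mul_assocEmb_mul_le [LocallyCompactSpace G] (P : MaxSpace 𝒢.ReducedCStar)
    (U : 𝒢.MS) (Q : MaxSpace 𝒢.ReducedCStar) :
    𝒢.assocRet (P * 𝒢.assocEmb U * Q) ≤ 𝒢.assocRet P * U * 𝒢.assocRet Q := by
  have h := 𝒢.assocRet_mul_le (P * 𝒢.assocEmb U) Q
  rwa [assocRet_mul_assocEmb] at h

theorem isPersistentObserver [LocallyCompactSpace G] (hp : 𝒢.IsPrincipal)
    (ho : 𝒢.HasDiscreteOrbits) : IsPersistentObserver 𝒢.assocEmb 𝒢.assocRet where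
  toIsObserver := 𝒢.isObserver
  persistent P U Q := by
    refine le_antisymm (𝒢.assocRet_mul_assocEmb_mul_le P U Q) ?_
    rintro _ ⟨_, ⟨g, hg, h, hh, hgh, rfl⟩, k, hk, hhk, rfl⟩
    rw [𝒢.d_mul _ _ hgh] at hhk
    obtain ⟨S, hS, hSg⟩ := 𝒢.mem_assocRet.1 hg
    obtain ⟨T, hT, hTk⟩ := 𝒢.mem_assocRet.1 hk
    have hrh : 𝒢.r h ∈ 𝒢.orbit (𝒢.d k) := ⟨𝒢.mul h k, 𝒢.d_mul _ _ hhk, 𝒢.r_mul _ _ hhk⟩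
    have := ho (𝒢.d k)
    -- Discreteness of the orbit yields an open `V` that meets it only in `r h`; the bump `f` is
    -- then restricted to arrows with range in `V`.
    obtain ⟨V, hV, hVr⟩ := isOpen_induced_iff.1
      (isOpen_discrete ({⟨𝒢.r h, hrh⟩} : Set (𝒢.orbit (𝒢.d k))))
    have hVorb : ∀ y ∈ V, y ∈ 𝒢.orbit (𝒢.d k) → y = 𝒢.r h := fun y hy hyo => by
      have : (⟨y, hyo⟩ : 𝒢.orbit (𝒢.d k)) ∈ ({⟨𝒢.r h, hrh⟩} : Set (𝒢.orbit (𝒢.d k))) := by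
        rw [← hVr]
        exact hy
      exact congrArg Subtype.val (Set.mem_singleton_iff.1 this)
    have hrV : 𝒢.r h ∈ V := by
      have : (⟨𝒢.r h, hrh⟩ : 𝒢.orbit (𝒢.d k)) ∈ Subtype.val ⁻¹' V := by
        rw [hVr]
        rfl
      exact this
    let U' : 𝒢.MS := U ⊓ ⟨𝒢.r ⁻¹' V, hV.preimage 𝒢.continuous_r⟩
    obtain ⟨f, hf, hfh, -, hfr⟩ := 𝒢.exists_bump_bisection (U := U') ⟨hh, hrV⟩
    refine 𝒢.mem_assocRet.2 ⟨S * 𝒢.ofCc f * T, MaxSpace.mul_mem_mul (MaxSpace.mul_mem_mul hS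
      (𝒢.ofCc_mem_assocEmb fun x hx => (hf hx).1)) hT, ?_⟩
    -- The value at `g (h k)` is `S(g) f(h) T(k)`: the inner product has one term since `f` sits on
    -- a bisection, and the outer one since `f T` meets the fibre only in `h k`.
    rw [mul_assoc, 𝒢.mul_assoc g h k hgh hhk, coeff_mul_right, 𝒢.coeff_mul_left hhk, coeff_ofCc,
      hfh, one_mul]
    · exact mul_ne_zero hSg hTk
    · intro l hl hl0
      rw [coeff_ofCc] at hl0
      exact hfr l hl hl0
    · rw [𝒢.r_mul _ _ hhk, hgh]
    · intro l hl hl0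
      obtain ⟨a, c, hac, rfl, ha, -⟩ := 𝒢.exists_of_coeff_mul_ne_zero hl0
      rw [coeff_ofCc] at ha
      -- The range of `l` lies in `V` and in the orbit, so it is `r h`; with trivial isotropy,
      -- domain and range determine `l`.
      refine (hp _).eq hl ?_
      rw [𝒢.r_mul _ _ hhk]
      refine hVorb _ ?_ ⟨_, hl.trans (𝒢.d_mul _ _ hhk), rfl⟩
      rw [𝒢.r_mul _ _ hac]
      exact (hf (subset_tsupport f ha)).2

theorem isPrincipal_of_isPersistentObserver [LocallyCompactSpace G]
    (h : IsPersistentObserver 𝒢.assocEmb 𝒢.assocRet) : 𝒢.IsPrincipal := by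
  classical
  rintro x g hd hr
  by_contra hne
  obtain ⟨b, -, hbg, hbd, -⟩ := 𝒢.exists_bump_bisection (U := ⊤) (MS.mem_top (g := g))
  obtain ⟨c, -, hcx, hcd, -⟩ := 𝒢.exists_bump_bisection (U := ⊤) (MS.mem_top (g := 𝒢.u x))
  have hbx : b (𝒢.u x) = 0 := by
    by_contra h0
    exact hne (hbd _ (by rw [𝒢.d_u, hd]) h0).symm
  have hcg : c g = 0 := by
    by_contra h0
    exact hne (hcd _ (by rw [𝒢.d_u, hd]) h0)
  -- The opposite signs of `b` in `T` and `S` are what makes the two terms of the convolution at `g`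
  -- cancel.
  set T := 𝒢.ofCc c + 𝒢.ofCc b
  set S := 𝒢.ofCc c - 𝒢.ofCc b
  have hTx : 𝒢.coeff T (𝒢.u x) = 1 := by rw [coeff_add, coeff_ofCc, coeff_ofCc, hcx, hbx, add_zero]
  have hTg : 𝒢.coeff T g = 1 := by rw [coeff_add, coeff_ofCc, coeff_ofCc, hcg, hbg, zero_add]
  have hSx : 𝒢.coeff S (𝒢.u x) = 1 := by rw [coeff_sub, coeff_ofCc, coeff_ofCc, hcx, hbx, sub_zero]
  have hSg : 𝒢.coeff S g = -1 := by rw [coeff_sub, coeff_ofCc, coeff_ofCc, hcg, hbg, zero_sub]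
  have hS : ∀ l, 𝒢.d l = x → l ≠ g → l ≠ 𝒢.u x → 𝒢.coeff S l = 0 := by
    intro l hl hlg hlx
    have h1 : b l = 0 := by
      by_contra h0
      exact hlg (hbd l (hl.trans hd.symm) h0)
    have h2 : c l = 0 := by
      by_contra h0
      exact hlx (hcd l (by rw [hl, 𝒢.d_u]) h0)
    rw [coeff_sub, coeff_ofCc, coeff_ofCc, h1, h2, sub_zero]
  have hgxg : 𝒢.mul g (𝒢.u x) = g := by rw [← hd, 𝒢.mul_u]
  have hmem : g ∈ 𝒢.assocRet (MaxSpace.span T) * 1 * 𝒢.assocRet (MaxSpace.span S) := by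
    rw [MS.mul_one_eq, ← hgxg]
    refine MS.mul_mem_mul (𝒢.mem_assocRet.2 ⟨T, MaxSpace.mem_span_self T, ?_⟩)
      (𝒢.mem_assocRet.2 ⟨S, MaxSpace.mem_span_self S, ?_⟩) (by rw [hd, 𝒢.r_u])
    · rw [hTg]; exact one_ne_zero
    · rw [hSx]; exact one_ne_zero
  rw [← h.persistent] at hmem
  refine 𝒢.le_vanishingAt.1 (MaxSpace.mul_le.2 fun a ha s hs => ?_) hmem
  have h1 : MaxSpace.span T * 𝒢.assocEmb 1 ≤ (𝒢.vanishingAt g).comapMulRight S := by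
    refine MaxSpace.mul_le.2 fun t ht F hF => ?_
    have h2 : 𝒢.assocEmb 1 ≤ ((𝒢.vanishingAt g).comapMulRight S).comapMulLeft T := by
      refine 𝒢.assocEmb_le.2 fun f hf => ?_
      rw [MaxSpace.mem_comapMulLeft, MaxSpace.mem_comapMulRight, mem_vanishingAt, mul_assoc]
      have h3 := 𝒢.hasSum_coeff_mul T (𝒢.ofCc f * S) g
      have h4 := hasSum_sum_of_ne_finset_zero (L := SummationFilter.unconditional G)
        (s := {g, 𝒢.u x}) (fun l (hl : l ∉ _) => show 𝒢.kernel (𝒢.coeff T) g l * 𝒢.coeff (𝒢.ofCc f * S) l = 0 by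
          rw [Finset.mem_insert, Finset.mem_singleton, not_or] at hl
          by_cases hdl : 𝒢.d g = 𝒢.d l
          · rw [𝒢.coeff_ofCc_mul_of_units hf, hS l (hdl.symm.trans hd) hl.1 hl.2, mul_zero,
              mul_zero]
          · rw [𝒢.kernel_neg _ hdl, zero_mul])
      have hux : 𝒢.d g = 𝒢.d (𝒢.u x) := by rw [𝒢.d_u, hd]
      -- The remaining terms are `T(u x) f(u x) S(g)` and `T(g) f(u x) S(u x)`, with sum `-f(u x) +
      -- f(u x)`.
      rw [h3.unique h4, Finset.sum_pair hne, 𝒢.coeff_ofCc_mul_of_units hf,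
        𝒢.coeff_ofCc_mul_of_units hf, hSx, hSg, hr, 𝒢.r_u, 𝒢.kernel_pos _ rfl, 𝒢.kernel_pos _ hux,
        𝒢.mul_inv, 𝒢.inv_u, hgxg, hr, hTg, hTx]
      ring
    have h5 : MaxSpace.span T ≤ ((𝒢.vanishingAt g).comapMulRight S).comapMulRight F :=
      MaxSpace.span_le.2 (h2 hF)
    exact h5 ht
  have h6 : MaxSpace.span S ≤ (𝒢.vanishingAt g).comapMulLeft a := MaxSpace.span_le.2 (h1 ha)
  exact h6 hs

theorem isEtaleObserver [LocallyCompactSpace G] [SecondCountableTopology G] :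
    IsEtaleObserver 𝒢.assocEmb 𝒢.assocRet where
  toIsObserver := 𝒢.isObserver
  classical := MS.isClassicalMeasurementSpace
  inverseQuantalFrame := MS.isInverseQuantalFrame
  etale P U Q _ hQ := by
    rintro _ ⟨_, ⟨g, hg, h, hh, hgh, rfl⟩, k, hk, hhk, rfl⟩
    have hhk' := hhk
    rw [𝒢.d_mul _ _ hgh] at hhk'
    obtain ⟨S, hS, hSg⟩ := 𝒢.mem_assocRet.1 hg
    obtain ⟨T, hT, hTk⟩ := 𝒢.mem_assocRet.1 hk
    obtain ⟨f, hf, hfh, hfd, -⟩ := 𝒢.exists_bump_bisection hh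
    refine 𝒢.mem_assocRet.2 ⟨S * 𝒢.ofCc f * T, MaxSpace.mul_mem_mul (MaxSpace.mul_mem_mul hS
      (𝒢.ofCc_mem_assocEmb hf)) hT, ?_⟩
    -- Both convolutions have one term: `f` lives on a bisection, and `d` is injective on the
    -- partial unit `ρ(Q)`, which contains the open support of `T`.
    rw [𝒢.coeff_mul_right hhk, 𝒢.coeff_mul_right hgh (by rwa [coeff_ofCc]), coeff_ofCc, hfh,
      mul_one]
    · exact mul_ne_zero hSg hTk
    · intro l hl hl0
      exact MS.injOn_d_of_mul_star_le_one hQ.1 (𝒢.mem_assocRet.2 ⟨T, hT, hl0⟩) hk hl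

/-- For `S ∈ P`, `R ∈ P*` and `f` supported on the units, `S f R` lies in `P P*`, hence in `ι(e)`,
and so vanishes at nonunits. Varying `f` isolates the single product `S(g) R(h)`. -/
theorem assocRet_mul_star_le_one [LocallyCompactSpace G] (ht : 𝒢.IsTopologicallyPrincipal)
    {P : MaxSpace 𝒢.ReducedCStar} (h1 : P * star P ≤ 𝒢.assocEmb 1) (h2 : P * 𝒢.assocEmb 1 ≤ P) :
    𝒢.assocRet P * star (𝒢.assocRet P) ≤ 1 := by
  classical
  by_contra hc
  obtain ⟨y, hy, hy1⟩ : ∃ y ∈ 𝒢.assocRet P * star (𝒢.assocRet P), y ∉ (1 : 𝒢.MS) := by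
    by_contra! hcon
    exact hc hcon
  have hopen : IsOpen (((𝒢.assocRet P * star (𝒢.assocRet P) : 𝒢.MS) : Set G) \ Set.range 𝒢.u) :=
    (MS.isOpen_coe _).sdiff 𝒢.isClosed_range_u
  -- The units are closed and `d` is open, so density allows replacing `y` by a nonunit `y'` whose
  -- domain has trivial isotropy.
  obtain ⟨_, hx, y', ⟨hy', hy1'⟩, rfl⟩ := ht.inter_open_nonempty _
    (𝒢.isLocalHomeomorph_d.isOpenMap _ hopen) ⟨_, y, ⟨hy, hy1⟩, rfl⟩ |>.imp fun _ h => h.symm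
  obtain ⟨g, hg, h, hh, hgh, e⟩ := hy'
  obtain ⟨S, hS, hSg⟩ := 𝒢.mem_assocRet.1 hg
  rw [← assocRet_star] at hh
  obtain ⟨R, hR, hRh⟩ := 𝒢.mem_assocRet.1 hh
  have hdy : 𝒢.d y' = 𝒢.d h := by rw [← e, 𝒢.d_mul _ _ hgh]
  have key : 𝒢.kernel (𝒢.coeff S) y' h * 𝒢.coeff R h = 0 := by
    refine eq_zero_of_forall_hasSum_mul (𝒢.hasSum_coeff_mul S R y').summable h fun F hF => ?_
    -- The finitely many units at which `f` must vanish. The unit at `r h` is left out, as `f` has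
    -- the value `1` there.
    let B : Finset G := (F.image fun k => 𝒢.u (𝒢.r k)).erase (𝒢.u (𝒢.r h))
    obtain ⟨f, hf, hfh, hf1⟩ := exists_bump_singleton (g := 𝒢.u (𝒢.r h))
      (U := (1 : 𝒢.MS) ∩ (B : Set G)ᶜ)
      ((MS.isOpen_coe 1).inter B.finite_toSet.isClosed.isOpen_compl)
      ⟨MS.u_mem_one _, fun hB => Finset.notMem_erase _ _ (Finset.mem_coe.1 hB)⟩
    have hfe : tsupport f ⊆ (1 : 𝒢.MS) := fun z hz => (hf hz).1
    refine ⟨fun k => f (𝒢.u (𝒢.r k)), hfh, fun k => hf1 _, fun k hk => ?_, ?_⟩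
    · by_cases hrk : 𝒢.u (𝒢.r k) = 𝒢.u (𝒢.r h)
      · have hkh : 𝒢.d y' ≠ 𝒢.d k := by
          intro hdk
          refine hF ?_
          rw [hdy] at hx
          have hr : 𝒢.r k = 𝒢.r h := by rw [← 𝒢.d_u (𝒢.r k), hrk, 𝒢.d_u]
          rwa [hx.eq (hdk.symm.trans hdy) hr] at hk
        rw [𝒢.kernel_neg _ hkh, zero_mul, mul_zero]
      · have : f (𝒢.u (𝒢.r k)) = 0 := by
          by_contra h0
          exact (hf (subset_tsupport f h0)).2 (Finset.mem_coe.2 (Finset.mem_erase.2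
            ⟨hrk, Finset.mem_image_of_mem _ hk⟩))
        simp only [this, zero_mul]
    · have hz : 𝒢.coeff (S * (𝒢.ofCc f * R)) y' = 0 := by
        have hm : S * (𝒢.ofCc f * R) ∈ 𝒢.assocEmb 1 := by
          rw [← mul_assoc]
          exact h1 (MaxSpace.mul_mem_mul
            (h2 (MaxSpace.mul_mem_mul hS (𝒢.ofCc_mem_assocEmb hfe))) hR)
        by_contra h0
        have := 𝒢.mem_assocRet.2 ⟨_, hm, h0⟩
        rw [assocRet_assocEmb] at this
        exact hy1' this
      have hs := 𝒢.hasSum_coeff_mul S (𝒢.ofCc f * R) y'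
      rw [hz] at hs
      refine (congrArg (fun a => HasSum a (0 : ℂ)) (funext fun k => ?_)).mp hs
      rw [𝒢.coeff_ofCc_mul_of_units hfe, mul_left_comm]
  rw [𝒢.kernel_pos _ hdy, ← e, 𝒢.mul_mul_inv_cancel hgh] at key
  exact mul_ne_zero hSg hRh key

theorem isIStableObserver [LocallyCompactSpace G] [SecondCountableTopology G]
    (ht : 𝒢.IsTopologicallyPrincipal) : IsIStableObserver 𝒢.assocEmb 𝒢.assocRet where
  toIsEtaleObserver := 𝒢.isEtaleObserver
  istable := by
    rintro P ⟨h1, h2, h3, h4⟩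
    refine ⟨𝒢.assocRet_mul_star_le_one ht h1 h3, ?_⟩
    -- The other inequality for a partial unit is the first one applied to `P*`, which needs the
    -- left-hand condition on `P`.
    have h5 : star P * 𝒢.assocEmb 1 ≤ star P := by
      rw [← MaxSpace.star_le, MaxSpace.star_mul_eq, ← assocEmb_star, MS.star_one_eq,
        MaxSpace.star_star_eq]
      exact h4
    have h6 := 𝒢.assocRet_mul_star_le_one ht (P := star P)
      (by rwa [MaxSpace.star_star_eq]) h5
    rwa [assocRet_star, MS.star_star_eq] at h6

end EtaleGroupoid

theorem mainTheorem2 {X G : Type*} [TopologicalSpace X] [TopologicalSpace G] [T2Space G]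
    [LocallyCompactSpace G] [SecondCountableTopology G] (𝒢 : EtaleGroupoid X G) :
    IsObserver 𝒢.assocEmb 𝒢.assocRet ∧
    (𝒢.IsPrincipal ∧ 𝒢.HasDiscreteOrbits → IsPersistentObserver 𝒢.assocEmb 𝒢.assocRet) ∧
    (IsPersistentObserver 𝒢.assocEmb 𝒢.assocRet → 𝒢.IsPrincipal) ∧
    (𝒢.IsTopologicallyPrincipal → IsIStableObserver 𝒢.assocEmb 𝒢.assocRet) :=
  ⟨𝒢.isObserver, fun h => 𝒢.isPersistentObserver h.1 h.2, 𝒢.isPrincipal_of_isPersistentObserver,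
    𝒢.isIStableObserver⟩
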